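/- Let $\Bbbk$ be an algebraically closed field of characteristic zero and $n\ge 0$. Let $PI_n^*$ be the monoid of all bijections $\xi$ from the set of parts of a set partition of a subset of $\underline n=\{1,\dots,n\}$ (the domain of $\xi$) to the set of parts of another set partition of a subset of $\underline n$ (the codomain of $\xi$). The product $\xi\zeta$ means "first $\zeta$, then $\xi$": points of $\underline n$ in the middle that lie in one part of $\mathrm{cod}(\zeta)$ or in one part of $\mathrm{dom}(\xi)$ are joined, and every connected component that contains a point at which $\mathrm{cod}(\zeta)$ or $\mathrm{dom}(\xi)$ is undefined is deleted together with everything attached to it. For a set partition $\rho$ of a subset of $\underline n$ with $k$ parts, let $\mathbf L_\rho$ be the left cell ($\mathcal L$-class) of the idempotent $\varepsilon_\rho$ (the identity map on the set of parts of $\rho$). The space $\Bbbk[\mathbf L_\rho]$ is a $PI_n^*$-module, where $\xi\cdot\zeta=\xi\zeta$ if $\xi\zeta\in\mathbf L_\rho$ and $\xi\cdot\zeta=0$ otherwise, and $S_k$, identified with the group of permutations of the parts of $\rho$ by a linear ordering of these parts, acts on it by right multiplication. For a partition $\lambda\vdash k$ with Specht module $\mathbf S^\lambda$, let $\mathbf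 N^\lambda=\Bbbk[\mathbf L_\rho]\otimes_{\Bbbk[S_k]}\mathbf S^\lambda$ be the corresponding simple $PI_n^*$-module. Up to isomorphism it does not depend on the choice of $\rho$ and of the ordering. Tensor products over $\Bbbk$ of $PI_n^*$-modules carry the diagonal action, and $[V:S]$ denotes the (Jordan–Hölder) multiplicity of $S$ in $V$. For $k,l,m\ge 0$, let $\tilde Q_{k,l}^m$ be the set of all $0/1$-matrices with rows indexed by $\{0,1,\dots,k\}$ and columns indexed by $\{0,1,\dots,l\}$ whose $(0,0)$-entry is $0$, which have exactly $m$ entries equal to $1$, and in which every row and every column of positive index is non-zero. The group $G=S_k\times S_l$ acts on $\tilde Q_{k,l}^m$ by permuting the rows and columns of positive index. For $M\in\tilde Q_{k,l}^m$, let $H_M$ be the stabilizer of $M$ in $G$. It permutes the $m$ entries of $M$ equal to $1$, and a choice of a bijection between $\underline m$ and these entries identifies $H_M$ with a subgroup of $S_m$. Let $k,l,m\le n$ and $\lambda\vdash k$, $\mu\vdash l$, $\nu\vdash m$. Then, for every cross-section $C$ of the set of orbits $\tilde Q_{k,l}^m/G$ (and all choices of the bijections above), $$\left[\mathbf N^\lambda\otimes_\Bbbk\mathbf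 N^\mu:\mathbf N^\nu\right]=\sum_{M\in C}\left[\mathrm{Ind}^{S_m}_{H_M}\mathrm{Res}^{G}_{H_M}\big(\mathbf S^\lambda\otimes_\Bbbk\mathbf S^\mu\big):\mathbf S^\nu\right].$$ -/

import Mathlib

open scoped TensorProduct

/-! ### Jordan–Hölder multiplicities -/

section Multiplicity

/-- The number of factors `c (i+1) / c i` of a series of submodules that are isomorphic to `S`. -/
noncomputable def factorCount (R : Type*) [Ring R] {M : Type*} [AddCommGroup M] [Module R M]
    (S : Type*) [AddCommGroup S] [Module R S] (c : CompositionSeries (Submodule R M)) : ℕ :=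
  Nat.card {i : Fin c.length //
    Nonempty ((↥(c i.succ) ⧸ (c i.castSucc).comap (c i.succ).subtype) ≃ₗ[R] S)}

open Classical in
/-- The multiplicity `[M : S]` of a simple module `S` in a module `M` of finite length: the number of factors isomorphic to `S` in a composition series
`⊥ = c 0 ⋖ c 1 ⋖ ⋯ ⋖ c r = ⊤` of `M`. It does not depend on the series
(`moduleMultiplicity_eq_factorCount`). -/
noncomputable def moduleMultiplicity (R : Type*) [Ring R] (M : Type*) [AddCommGroup M] [Module R M]
    (S : Type*) [AddCommGroup S] [Module R S] : ℕ :=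
  if h : ∃ c : CompositionSeries (Submodule R M), c.head = ⊥ ∧ c.last = ⊤ then
    factorCount R S h.choose
  else 0

theorem moduleMultiplicity_eq_factorCount (R : Type*) [Ring R] (M : Type*) [AddCommGroup M]
    [Module R M] (S : Type*) [AddCommGroup S] [Module R S] (c : CompositionSeries (Submodule R M))
    (h₀ : c.head = ⊥) (h₁ : c.last = ⊤) : moduleMultiplicity R M S = factorCount R S c := by
  have h : ∃ c : CompositionSeries (Submodule R M), c.head = ⊥ ∧ c.last = ⊤ := ⟨c, h₀, h₁⟩
  rw [moduleMultiplicity, dif_pos h]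
  obtain ⟨f, hf⟩ := CompositionSeries.jordan_holder h.choose c
    (h.choose_spec.1.trans h₀.symm) (h.choose_spec.2.trans h₁.symm)
  refine Nat.card_congr (f.subtypeEquiv fun i => ?_)
  have e := JordanHolderLattice.Iso.linearEquiv (hf i)
  exact ⟨fun ⟨g⟩ => ⟨e.symm.trans g⟩, fun ⟨g⟩ => ⟨e.trans g⟩⟩

/-- The multiplicity `[V : S]` for representations of a monoid `G` over `𝕜`, regarded as modules
over the monoid algebra of `G`. -/
noncomputable def repMultiplicity {𝕜 G V S : Type*} [Field 𝕜] [Monoid G]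
    [AddCommGroup V] [Module 𝕜 V] [AddCommGroup S] [Module 𝕜 S]
    (ρ : Representation 𝕜 G V) (σ : Representation 𝕜 G S) : ℕ :=
  moduleMultiplicity (MonoidAlgebra 𝕜 G) ρ.asModule σ.asModule

end Multiplicity

/-! ### Specht modules -/

section Specht

/-- A (bijective) Young tableau of shape `lam` with entries in `Fin k`; there are none unless
`lam` is a partition of `k`. -/
abbrev Tableau (lam : YoungDiagram) (k : ℕ) : Type := {c : ℕ × ℕ // c ∈ lam} ≃ Fin k

/-- The tabloid `{t}` of a tableau `t`, encoded as the function that sends each entry to the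
index of its row: two tableaux have the same tabloid iff corresponding rows have the same
entries. -/
def Tableau.tabloid {lam : YoungDiagram} {k : ℕ} (t : Tableau lam k) : Fin k → ℕ :=
  fun i => (t.symm i).1.1

/-- The column stabilizer of a tableau. -/
def Tableau.colStab {lam : YoungDiagram} {k : ℕ} (t : Tableau lam k) :
    Set (Equiv.Perm (Fin k)) :=
  {p | ∀ i, (t.symm (p i)).1.2 = (t.symm i).1.2}

/-- The permutation representation of `S_k` on formal combinations of (encoded) tabloids. -/
noncomputable def tabloidRep (𝕜 : Type*) [Field 𝕜] (k : ℕ) :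
    Representation 𝕜 (Equiv.Perm (Fin k)) ((Fin k → ℕ) →₀ 𝕜) where
  toFun p := Finsupp.lmapDomain 𝕜 𝕜 fun f => f ∘ p.symm
  map_one' := by ext; simp [Equiv.Perm.one_def]
  map_mul' p q := by
    ext1 f
    ext1
    simp [Equiv.Perm.mul_def, Finsupp.mapDomain_single, Function.comp_assoc]

open Classical in
/-- The polytabloid `e_t = ∑ sgn(p) • p{t}`, the sum being over the column stabilizer of `t`. -/
noncomputable def polytabloid (𝕜 : Type*) [Field 𝕜] {lam : YoungDiagram} {k : ℕ}
    (t : Tableau lam k) : (Fin k → ℕ) →₀ 𝕜 :=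
  ∑ p : Equiv.Perm (Fin k), if p ∈ t.colStab then
    ((Equiv.Perm.sign p : ℤ) : 𝕜) • tabloidRep 𝕜 k p (Finsupp.single t.tabloid 1) else 0

/-- The space of the Specht module: the span of all polytabloids of shape `lam`. -/
noncomputable def spechtSpace (𝕜 : Type*) [Field 𝕜] (lam : YoungDiagram) (k : ℕ) :
    Submodule 𝕜 ((Fin k → ℕ) →₀ 𝕜) :=
  Submodule.span 𝕜 (Set.range fun t : Tableau lam k => polytabloid 𝕜 t)

theorem tabloidRep_polytabloid (𝕜 : Type*) [Field 𝕜] {lam : YoungDiagram} {k : ℕ}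
    (t : Tableau lam k) (q : Equiv.Perm (Fin k)) :
    tabloidRep 𝕜 k q (polytabloid 𝕜 t) = polytabloid 𝕜 (t.trans q) := by
  classical
  have ht : Tableau.tabloid (t.trans q) = t.tabloid ∘ q.symm := rfl
  have hs : Finsupp.single (Tableau.tabloid (t.trans q)) (1 : 𝕜) =
      tabloidRep 𝕜 k q (Finsupp.single t.tabloid 1) := by
    simp [tabloidRep, ht, Finsupp.mapDomain_single]
  unfold polytabloid
  rw [map_sum]
  refine Fintype.sum_equiv (MulAut.conj q).toEquiv _ _ fun p => ?_
  have hmem : (MulAut.conj q) p ∈ Tableau.colStab (t.trans q) ↔ p ∈ t.colStab := by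
    simp only [Tableau.colStab, Set.mem_ofPred_eq, MulAut.conj_apply, Equiv.symm_trans_apply,
      Equiv.Perm.mul_apply, Equiv.symm_apply_apply]
    refine ⟨fun h i => ?_, fun h i => ?_⟩
    · simpa using h (q i)
    · exact h _
  have hsg : Equiv.Perm.sign ((MulAut.conj q) p) = Equiv.Perm.sign p := by
    rw [MulAut.conj_apply, Equiv.Perm.sign_mul, Equiv.Perm.sign_mul, mul_comm, ← mul_assoc,
      ← Equiv.Perm.sign_mul, inv_mul_cancel, Equiv.Perm.sign_one, one_mul]
  change _ = if (MulAut.conj q) p ∈ _ then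
    ((Equiv.Perm.sign ((MulAut.conj q) p) : ℤ) : 𝕜) •
      tabloidRep 𝕜 k ((MulAut.conj q) p) _ else 0
  by_cases h : p ∈ t.colStab
  · rw [if_pos h, if_pos (hmem.2 h), hsg, hs, map_smul, ← Module.End.mul_apply,
      ← Module.End.mul_apply, ← map_mul, ← map_mul, MulAut.conj_apply, inv_mul_cancel_right]
  · rw [if_neg h, if_neg (fun h' => h (hmem.1 h')), map_zero]

/-- The space of the Specht module, as a type. -/
def SpechtModule (𝕜 : Type*) [Field 𝕜] (lam : YoungDiagram) (k : ℕ) : Type _ :=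
  ↥(spechtSpace 𝕜 lam k)

noncomputable instance (𝕜 : Type*) [Field 𝕜] (lam : YoungDiagram) (k : ℕ) :
    AddCommGroup (SpechtModule 𝕜 lam k) :=
  inferInstanceAs (AddCommGroup ↥(spechtSpace 𝕜 lam k))

noncomputable instance (𝕜 : Type*) [Field 𝕜] (lam : YoungDiagram) (k : ℕ) :
    Module 𝕜 (SpechtModule 𝕜 lam k) :=
  inferInstanceAs (Module 𝕜 ↥(spechtSpace 𝕜 lam k))

/-- The Specht module `S^lam` of `S_k` for a partition `lam` of `k`: the span of the polytabloids
with the action of `S_k` on tabloids. -/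
noncomputable def specht (𝕜 : Type*) [Field 𝕜] (lam : YoungDiagram) (k : ℕ) :
    Representation 𝕜 (Equiv.Perm (Fin k)) (SpechtModule 𝕜 lam k) :=
  (tabloidRep 𝕜 k).subrepresentation (spechtSpace 𝕜 lam k) fun q => by
    rw [spechtSpace, Submodule.span_le]
    rintro _ ⟨t, rfl⟩
    change tabloidRep 𝕜 k q (polytabloid 𝕜 t) ∈ spechtSpace 𝕜 lam k
    rw [tabloidRep_polytabloid, spechtSpace]
    exact Submodule.subset_span ⟨t.trans q, rfl⟩

/-- The external tensor product of a representation of `G₁` and one of `G₂`, a representation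
of `G₁ × G₂`. -/
noncomputable def extTensor {𝕜 G₁ G₂ V W : Type*} [Field 𝕜] [Group G₁] [Group G₂]
    [AddCommGroup V] [Module 𝕜 V] [AddCommGroup W] [Module 𝕜 W]
    (ρ : Representation 𝕜 G₁ V) (σ : Representation 𝕜 G₂ W) :
    Representation 𝕜 (G₁ × G₂) (V ⊗[𝕜] W) :=
  Representation.tprod (ρ.comp (MonoidHom.fst G₁ G₂)) (σ.comp (MonoidHom.snd G₁ G₂))

end Specht

/-! ### Left cells and cell modules of a monoid -/

section Cells

/-- Green's relation `𝓛`: `x` and `y` generate the same left ideal. -/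
def GreenL {M : Type*} [Monoid M] (x y : M) : Prop :=
  (∃ a, a * x = y) ∧ ∃ b, b * y = x

/-- The left cell (`𝓛`-class) of `e`. -/
abbrev LeftCell {M : Type*} [Monoid M] (e : M) : Type _ := {x : M // GreenL x e}

theorem GreenL.of_mul {M : Type*} [Monoid M] {e x a : M} (hx : ∃ b, b * e = x)
    (h : GreenL (a * x) e) : GreenL x e := by
  obtain ⟨⟨c, hc⟩, -⟩ := h
  exact ⟨⟨c * a, by rw [mul_assoc, hc]⟩, hx⟩

open Classical in
/-- The cell module `𝕜[L]` of the left cell `L` of `e`: the element `a` sends a basis element `x`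
to `a * x` if this lies in `L`, and to `0` otherwise. -/
noncomputable def cellRep (𝕜 : Type*) [Field 𝕜] {M : Type*} [Monoid M] (e : M) :
    Representation 𝕜 M (LeftCell e →₀ 𝕜) where
  toFun a := Finsupp.linearCombination 𝕜 fun x : LeftCell e =>
    if h : GreenL (a * x.1) e then Finsupp.single (⟨a * x.1, h⟩ : LeftCell e) (1 : 𝕜) else 0
  map_one' := by
    ext1 x
    ext1
    have h : GreenL (1 * x.1) e := by rw [one_mul]; exact x.2
    simp only [LinearMap.comp_apply, Finsupp.lsingle_apply, Finsupp.linearCombination_single,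
      one_smul, dif_pos h, Module.End.one_apply]
    congr 1
    exact Subtype.ext (one_mul _)
  map_mul' a b := by
    ext1 x
    ext1
    simp only [LinearMap.comp_apply, Finsupp.lsingle_apply, Finsupp.linearCombination_single,
      one_smul, Module.End.mul_apply]
    by_cases hb : GreenL (b * x.1) e
    · rw [dif_pos hb, Finsupp.linearCombination_single, one_smul]
      simp only [mul_assoc]
    · have hab : ¬ GreenL (a * b * x.1) e := fun h => hb <| by
        obtain ⟨y, hy⟩ := x.2.2
        rw [mul_assoc] at h
        exact GreenL.of_mul ⟨b * y, by rw [mul_assoc, hy]⟩ h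
      rw [dif_neg hb, dif_neg hab, map_zero]

/-- A group `G` mapped multiplicatively into `M` (so that `g 1` is an idempotent and the image lies
in the maximal subgroup at `g 1`) acts on the left cell of `g 1` by right multiplication. -/
def LeftCell.mulRight {M G : Type*} [Monoid M] [Group G] (g : G →ₙ* M) (s : G)
    (x : LeftCell (g 1)) : LeftCell (g 1) :=
  ⟨x.1 * g s, by
    obtain ⟨⟨a, ha⟩, -⟩ := x.2
    refine ⟨⟨g s⁻¹ * a, ?_⟩, ⟨x.1 * g s, ?_⟩⟩
    · rw [mul_assoc, ← mul_assoc a, ha, ← map_mul, ← map_mul]; simp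
    · rw [mul_assoc, ← map_mul, mul_one]⟩

/-- The right action of `G` on `𝕜[L]` by right multiplication, turned into a left action by
`s ↦ s⁻¹`. -/
noncomputable def cellRightRep (𝕜 : Type*) [Field 𝕜] {M G : Type*} [Monoid M] [Group G]
    (g : G →ₙ* M) : Representation 𝕜 G (LeftCell (g 1) →₀ 𝕜) where
  toFun s := Finsupp.lmapDomain 𝕜 𝕜 (LeftCell.mulRight g s⁻¹)
  map_one' := by
    ext1 x
    ext1
    simp only [LinearMap.comp_apply, Finsupp.lsingle_apply, Finsupp.lmapDomain_apply,
      Finsupp.mapDomain_single, Module.End.one_apply]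
    congr 1
    apply Subtype.ext
    obtain ⟨b, hb⟩ := x.2.2
    change x.1 * g 1⁻¹ = x.1
    rw [← hb, mul_assoc, ← map_mul]; simp
  map_mul' s t := by
    ext1 x
    ext1
    simp only [LinearMap.comp_apply, Finsupp.lsingle_apply, Finsupp.lmapDomain_apply,
      Finsupp.mapDomain_single, Module.End.mul_apply]
    congr 1
    apply Subtype.ext
    change x.1 * g (s * t)⁻¹ = x.1 * g t⁻¹ * g s⁻¹
    rw [mul_assoc, ← map_mul, mul_inv_rev]

theorem cellRep_comm (𝕜 : Type*) [Field 𝕜] {M G : Type*} [Monoid M] [Group G]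
    (g : G →ₙ* M) (a : M) (s : G) :
    cellRep 𝕜 (g 1) a ∘ₗ cellRightRep 𝕜 g s = cellRightRep 𝕜 g s ∘ₗ cellRep 𝕜 (g 1) a := by
  ext1 x
  ext1
  simp only [LinearMap.comp_apply, Finsupp.lsingle_apply, cellRep, cellRightRep, MonoidHom.coe_mk,
    OneHom.coe_mk, Finsupp.lmapDomain_apply, Finsupp.mapDomain_single,
    Finsupp.linearCombination_single, one_smul]
  by_cases h : GreenL (a * x.1) (g 1)
  · have h' : GreenL (a * (LeftCell.mulRight g s⁻¹ x).1) (g 1) := by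
      have := (LeftCell.mulRight g s⁻¹ ⟨a * x.1, h⟩).2
      simpa [LeftCell.mulRight, mul_assoc] using this
    rw [dif_pos h, dif_pos h', Finsupp.mapDomain_single]
    congr 1
    exact Subtype.ext (mul_assoc _ _ _).symm
  · have h' : ¬ GreenL (a * (LeftCell.mulRight g s⁻¹ x).1) (g 1) := fun h' => h <| by
      have := (LeftCell.mulRight g s ⟨_, h'⟩).2
      obtain ⟨b, hb⟩ := x.2.2
      have hx : x.1 * g s⁻¹ * g s = x.1 := by
        rw [← hb, mul_assoc, mul_assoc, ← map_mul, ← map_mul]; simp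
      have h2 : a * (x.1 * g s⁻¹) * g s = a * x.1 := by rw [mul_assoc, hx]
      exact h2 ▸ this
    rw [dif_neg h, dif_neg h', Finsupp.mapDomain_zero]

/-- The `𝕜`-space `𝕜[L] ⊗_{𝕜[G]} V`: the quotient of `𝕜[L] ⊗ V` by the span of all
`x s⁻¹ ⊗ s v - x ⊗ v`. -/
abbrev CellIndSpace {𝕜 M G V : Type*} [Field 𝕜] [Monoid M] [Group G] [AddCommGroup V] [Module 𝕜 V]
    (g : G →ₙ* M) (σ : Representation 𝕜 G V) : Type _ :=
  Representation.Coinvariants (V := (LeftCell (g 1) →₀ 𝕜) ⊗[𝕜] V)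
    (Representation.tprod (cellRightRep 𝕜 g) σ)

/-- The `M`-module `𝕜[L] ⊗_{𝕜[G]} V`, with `a • (x ⊗ v) = (a • x) ⊗ v`. -/
noncomputable def cellInd {𝕜 M G V : Type*} [Field 𝕜] [Monoid M] [Group G]
    [AddCommGroup V] [Module 𝕜 V] (g : G →ₙ* M) (σ : Representation 𝕜 G V) :
    Representation 𝕜 M (CellIndSpace g σ) where
  toFun a := Representation.Coinvariants.map _ _
    ⟨(cellRep 𝕜 (g 1) a).rTensor V, fun s => by
      rw [Representation.tprod_apply, LinearMap.rTensor_comp_map, LinearMap.map_comp_rTensor,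
        cellRep_comm]⟩
  map_one' := by
    apply Representation.Coinvariants.hom_ext
    ext
    simp
  map_mul' a b := by
    apply Representation.Coinvariants.hom_ext
    ext
    simp

end Cells

/-! ### The inverse monoid of bijections between subquotients of a finite set -/

section PIStar

/-- An element of `PI_n^*`, that is, a bijection from the set of parts of a set partition of a
subset `X` of `Fin n` to the set of parts of a set partition of a subset `Y`. It is encoded by the
relation `rel a b`: "`a ∈ X`, `b ∈ Y`, and the part of `a` is mapped to the part of `b`". The
relations that arise in this way are exactly the difunctional ones. -/
@[ext]
structure PIStar (n : ℕ) where
  rel : Fin n → Fin n → Prop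
  difunctional : ∀ {a b c d}, rel a b → rel c b → rel c d → rel a d

namespace PIStar

variable {n : ℕ}

/-- `x` lies in the subset of `Fin n` that the domain of `ξ` partitions. -/
def InDom (ξ : PIStar n) (x : Fin n) : Prop := ∃ b, ξ.rel x b

/-- `x` lies in the subset of `Fin n` that the codomain of `ξ` partitions. -/
def InCod (ξ : PIStar n) (x : Fin n) : Prop := ∃ a, ξ.rel a x

/-- `x` and `y` lie in the same part of the domain of `ξ`. -/
def SameDom (ξ : PIStar n) (x y : Fin n) : Prop := ∃ b, ξ.rel x b ∧ ξ.rel y b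

/-- `x` and `y` lie in the same part of the codomain of `ξ`. -/
def SameCod (ξ : PIStar n) (x y : Fin n) : Prop := ∃ a, ξ.rel a x ∧ ξ.rel a y

/-- `x` and `y` are connected in the middle of the composite "first `ζ`, then `ξ`". -/
def Conn (ξ ζ : PIStar n) : Fin n → Fin n → Prop :=
  Relation.EqvGen fun x y => ζ.SameCod x y ∨ ξ.SameDom x y

/-- No point connected to `x` hits an undefined part of `ζ` or `ξ`. -/
def Alive (ξ ζ : PIStar n) (x : Fin n) : Prop :=
  ∀ y, Conn ξ ζ x y → ζ.InCod y ∧ ξ.InDom y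

theorem Alive.conn {ξ ζ : PIStar n} {x y : Fin n} (h : Alive ξ ζ x) (hxy : Conn ξ ζ x y) :
    Alive ξ ζ y :=
  fun z hz => h z (hxy.trans _ _ _ hz)

/-- The composite "first `ζ`, then `ξ`": everything connected in the middle is merged, and
everything connected to an undefined point is removed. -/
def comp (ξ ζ : PIStar n) : PIStar n where
  rel a d := ∃ x y, ζ.rel a x ∧ Conn ξ ζ x y ∧ Alive ξ ζ x ∧ ξ.rel y d
  difunctional := by
    rintro a b c d ⟨x, y, hax, hxy, hx, hyb⟩ ⟨x', y', hcx', hxy', hx', hyb'⟩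
      ⟨x'', y'', hcx'', hxy'', hx'', hyd⟩
    refine ⟨x, y'', hax, ?_, hx, hyd⟩
    have h₁ : Conn ξ ζ y y' := .rel _ _ (Or.inr ⟨b, hyb, hyb'⟩)
    have h₂ : Conn ξ ζ x' x'' := .rel _ _ (Or.inl ⟨c, hcx', hcx''⟩)
    exact hxy.trans _ _ _ (h₁.trans _ _ _ ((hxy'.symm _ _).trans _ _ _ (h₂.trans _ _ _ hxy'')))

/-- The identity map on the partition of `Fin n` into singletons. -/
def id (n : ℕ) : PIStar n where
  rel a b := a = b
  difunctional := by rintro a b c d rfl rfl rfl; rfl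

/-- The least difunctional relation that contains `T`. -/
inductive Dif {α β : Type} (T : α → β → Prop) : α → β → Prop
  | base {a b} : T a b → Dif T a b
  | zig {a b c d} : Dif T a b → Dif T c b → Dif T c d → Dif T a d

/-- `ξ` extended by one point `none`, joined to all undefined points on both sides. -/
def hat (ξ : PIStar n) (x y : Option (Fin n)) : Prop :=
  (∃ a b, x = some a ∧ y = some b ∧ ξ.rel a b) ∨
    ((∀ a, x = some a → ¬ ξ.InDom a) ∧ ∀ b, y = some b → ¬ ξ.InCod b)

theorem hat_some (ξ : PIStar n) {a b : Fin n} : ξ.hat (some a) (some b) ↔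
    ξ.rel a b ∨ (¬ ξ.InDom a ∧ ¬ ξ.InCod b) := by
  simp [hat]

theorem hat_total (ξ : PIStar n) (x : Option (Fin n)) : ∃ y, ξ.hat x y := by
  by_cases h : ∃ a, x = some a ∧ ξ.InDom a
  · obtain ⟨a, rfl, b, hb⟩ := h
    exact ⟨some b, Or.inl ⟨a, b, rfl, rfl, hb⟩⟩
  · push Not at h
    exact ⟨none, Or.inr ⟨h, by simp⟩⟩

theorem hat_surj (ξ : PIStar n) (y : Option (Fin n)) : ∃ x, ξ.hat x y := by
  by_cases h : ∃ b, y = some b ∧ ξ.InCod b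
  · obtain ⟨b, rfl, a, ha⟩ := h
    exact ⟨some a, Or.inl ⟨a, b, rfl, rfl, ha⟩⟩
  · push Not at h
    exact ⟨none, Or.inr ⟨by simp, h⟩⟩

theorem hat_dif (ξ : PIStar n) {a b c d : Option (Fin n)} (h₁ : ξ.hat a b) (h₂ : ξ.hat c b)
    (h₃ : ξ.hat c d) : ξ.hat a d := by
  rcases h₁ with ⟨a', b', rfl, rfl, h₁⟩ | ⟨h₁, h₁'⟩ <;>
    rcases h₂ with ⟨c', b'', rfl, hb, h₂⟩ | ⟨h₂, h₂'⟩ <;>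
    rcases h₃ with ⟨c'', d', hc, rfl, h₃⟩ | ⟨h₃, h₃'⟩
  · cases hb; cases hc
    exact Or.inl ⟨_, _, rfl, rfl, ξ.difunctional h₁ h₂ h₃⟩
  · exact absurd ⟨_, h₂⟩ (h₃ _ rfl)
  · exact absurd ⟨_, h₁⟩ (h₂' _ rfl)
  · exact absurd ⟨_, h₁⟩ (h₂' _ rfl)
  · exact absurd ⟨_, h₂⟩ (h₁' _ hb)
  · exact absurd ⟨_, h₂⟩ (h₁' _ hb)
  · exact absurd ⟨_, h₃⟩ (h₂ _ hc)
  · exact Or.inr ⟨h₁, h₃'⟩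

theorem hat_injective {ξ ζ : PIStar n} (h : ∀ x y, ξ.hat x y ↔ ζ.hat x y) : ξ = ζ := by
  have key : ∀ ξ : PIStar n, ∀ a b, ξ.rel a b ↔ (ξ.hat (some a) (some b) ∧
      ¬ ξ.hat (some a) none) := by
    intro ξ a b
    rw [hat_some]
    constructor
    · intro hab
      refine ⟨Or.inl hab, ?_⟩
      rintro (⟨_, _, _, h, _⟩ | ⟨h, _⟩)
      · cases h
      · exact h a rfl ⟨b, hab⟩
    · rintro ⟨hab | ⟨ha, _⟩, h'⟩
      · exact hab
      · refine absurd (Or.inr ⟨?_, by simp⟩) h'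
        rintro _ ⟨⟩
        exact ha
  ext a b
  rw [key ξ, key ζ, h, h]

/-- Composition of relations, first `S`, then `R`. -/
def relComp {α β γ : Type} (R : β → γ → Prop) (S : α → β → Prop) (a : α) (c : γ) : Prop :=
  ∃ b, S a b ∧ R b c

theorem conn_hat {ξ ζ : PIStar n} {x y : Fin n} (h : Conn ξ ζ x y) {a d : Option (Fin n)}
    (ha : ζ.hat a (some x)) (hd : ξ.hat (some y) d) : Dif (relComp ξ.hat ζ.hat) a d := by
  induction h generalizing a d with
  | rel x y h =>
    rcases h with ⟨a₀, h₁, h₂⟩ | ⟨d₀, h₁, h₂⟩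
    · exact .base ⟨some y, ζ.hat_dif ha (ζ.hat_some.2 (Or.inl h₁)) (ζ.hat_some.2 (Or.inl h₂)), hd⟩
    · exact .base ⟨some x, ha,
        ξ.hat_dif (ξ.hat_some.2 (Or.inl h₁)) (ξ.hat_some.2 (Or.inl h₂)) hd⟩
  | refl x => exact .base ⟨_, ha, hd⟩
  | symm x y _ ih =>
    obtain ⟨a₀, ha₀⟩ := ζ.hat_surj (some x)
    obtain ⟨d₀, hd₀⟩ := ξ.hat_total (some y)
    exact .zig (.base ⟨_, ha, hd₀⟩) (ih ha₀ hd₀) (.base ⟨_, ha₀, hd⟩)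
  | trans x y z _ _ ih₁ ih₂ =>
    obtain ⟨a₀, ha₀⟩ := ζ.hat_surj (some y)
    obtain ⟨d₀, hd₀⟩ := ξ.hat_total (some y)
    exact .zig (ih₁ ha hd₀) (.base ⟨_, ha₀, hd₀⟩) (ih₂ ha₀ hd)

theorem dif_none_of_not_inDom {ξ ζ : PIStar n} {a : Option (Fin n)}
    (h : ∀ a', a = some a' → ¬ (comp ξ ζ).InDom a') : Dif (relComp ξ.hat ζ.hat) a none := by
  have h0 : ξ.hat none none := Or.inr ⟨by simp, by simp⟩
  by_cases hz : ∃ a', a = some a' ∧ ζ.InDom a'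
  · obtain ⟨a, rfl, x, hx⟩ := hz
    have hal : ¬ Alive ξ ζ x := fun hal => by
      obtain ⟨d, hd⟩ := (hal x (.refl x)).2
      exact h a rfl ⟨d, x, x, hx, .refl x, hal, hd⟩
    simp only [Alive, not_forall] at hal
    obtain ⟨y, hxy, hy⟩ := hal
    by_cases hyd : ξ.InDom y
    · have hyc : ¬ ζ.InCod y := fun hyc => hy ⟨hyc, hyd⟩
      obtain ⟨d, hd⟩ := hyd
      have hd' : ξ.hat (some y) (some d) := ξ.hat_some.2 (Or.inl hd)
      have h1 : ζ.hat none (some y) := Or.inr ⟨by simp, by rintro _ ⟨⟩; exact hyc⟩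
      have h2 : ζ.hat none none := Or.inr ⟨by simp, by simp⟩
      exact .zig (conn_hat hxy (ζ.hat_some.2 (Or.inl hx)) hd') (.base ⟨_, h1, hd'⟩)
        (.base ⟨_, h2, h0⟩)
    · exact conn_hat hxy (ζ.hat_some.2 (Or.inl hx)) (Or.inr ⟨by rintro _ ⟨⟩; exact hyd, by simp⟩)
  · push Not at hz
    exact .base ⟨none, Or.inr ⟨hz, by simp⟩, h0⟩

theorem dif_none_of_not_inCod {ξ ζ : PIStar n} {d : Option (Fin n)}
    (h : ∀ d', d = some d' → ¬ (comp ξ ζ).InCod d') : Dif (relComp ξ.hat ζ.hat) none d := by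
  have h0 : ζ.hat none none := Or.inr ⟨by simp, by simp⟩
  by_cases hz : ∃ d', d = some d' ∧ ξ.InCod d'
  · obtain ⟨d, rfl, x, hx⟩ := hz
    have hal : ¬ Alive ξ ζ x := fun hal => by
      obtain ⟨a, ha⟩ := (hal x (.refl x)).1
      exact h d rfl ⟨a, x, x, ha, .refl x, hal, hx⟩
    simp only [Alive, not_forall] at hal
    obtain ⟨y, hxy, hy⟩ := hal
    have hyx : Conn ξ ζ y x := hxy.symm _ _
    have hx' : ξ.hat (some x) (some d) := ξ.hat_some.2 (Or.inl hx)
    by_cases hyc : ζ.InCod y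
    · have hyd : ¬ ξ.InDom y := fun hyd => hy ⟨hyc, hyd⟩
      obtain ⟨a, ha⟩ := hyc
      have ha' : ζ.hat (some a) (some y) := ζ.hat_some.2 (Or.inl ha)
      have h1 : ξ.hat (some y) none := Or.inr ⟨by rintro _ ⟨⟩; exact hyd, by simp⟩
      have h2 : ξ.hat none none := Or.inr ⟨by simp, by simp⟩
      exact .zig (.base ⟨_, h0, h2⟩) (.base ⟨_, ha', h1⟩) (conn_hat hyx ha' hx')
    · exact conn_hat hyx (Or.inr ⟨by simp, by rintro _ ⟨⟩; exact hyc⟩) hx'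
  · push Not at hz
    exact .base ⟨none, h0, Or.inr ⟨by simp, hz⟩⟩

theorem hat_comp (ξ ζ : PIStar n) (a d : Option (Fin n)) :
    (comp ξ ζ).hat a d ↔ Dif (relComp ξ.hat ζ.hat) a d := by
  constructor
  · rintro (⟨a, d, rfl, rfl, x, y, hx, hxy, -, hy⟩ | ⟨ha, hd⟩)
    · exact conn_hat hxy (ζ.hat_some.2 (Or.inl hx)) (ξ.hat_some.2 (Or.inl hy))
    · exact .zig (dif_none_of_not_inDom ha)
        (.base ⟨none, Or.inr ⟨by simp, by simp⟩, Or.inr ⟨by simp, by simp⟩⟩)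
        (dif_none_of_not_inCod hd)
  · intro h
    induction h with
    | zig _ _ _ h₁ h₂ h₃ => exact hat_dif _ h₁ h₂ h₃
    | @base a d h =>
      obtain ⟨x, hax, hxd⟩ := h
      -- an alive middle point joins defined points only, a dead one undefined points only
      by_cases hal : ∃ x', x = some x' ∧ Alive ξ ζ x'
      · obtain ⟨x, rfl, hal⟩ := hal
        have hx := hal x (.refl x)
        rcases hax with ⟨a, _, rfl, ⟨⟩, hax⟩ | ⟨_, h⟩
        · rcases hxd with ⟨_, d, ⟨⟩, rfl, hxd⟩ | ⟨h, _⟩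
          · exact Or.inl ⟨a, d, rfl, rfl, x, x, hax, .refl x, hal, hxd⟩
          · exact absurd hx.2 (h x rfl)
        · exact absurd hx.1 (h x rfl)
      · push Not at hal
        refine Or.inr ⟨?_, ?_⟩
        · rintro a rfl ⟨d', x', y', hax', hxy', hal', -⟩
          rcases hax with ⟨a, x, ⟨⟩, rfl, hax⟩ | ⟨h, _⟩
          · exact hal x rfl (hal'.conn (.rel _ _ (Or.inl ⟨a, hax', hax⟩)))
          · exact h a rfl ⟨x', hax'⟩
        · rintro d rfl ⟨a', x', y', hax', hxy', hal', hyd'⟩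
          rcases hxd with ⟨x, d, rfl, ⟨⟩, hxd⟩ | ⟨_, h⟩
          · exact hal x rfl ((hal'.conn hxy').conn (.rel _ _ (Or.inr ⟨d, hyd', hxd⟩)))
          · exact h d rfl ⟨y', hyd'⟩

theorem Dif.le {α β : Type} {T U : α → β → Prop} (hU : ∀ {a b c d}, U a b → U c b → U c d → U a d)
    (h : ∀ a b, T a b → U a b) {a : α} {b : β} (hab : Dif T a b) : U a b := by
  induction hab with
  | base h' => exact h _ _ h'
  | zig _ _ _ h₁ h₂ h₃ => exact hU h₁ h₂ h₃

theorem dif_relComp_right {α β γ : Type} {R : β → γ → Prop} {T : α → β → Prop}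
    (hR : ∀ b, ∃ c, R b c) (a : α) (c : γ) :
    Dif (relComp R (Dif T)) a c ↔ Dif (relComp R T) a c := by
  constructor
  · refine Dif.le .zig ?_
    rintro a c ⟨b, hab, hbc⟩
    induction hab generalizing c with
    | base h => exact .base ⟨_, h, hbc⟩
    | zig _ _ _ h₁ h₂ h₃ =>
      obtain ⟨c', hc'⟩ := hR _
      exact .zig (h₁ _ hc') (h₂ _ hc') (h₃ _ hbc)
  · exact Dif.le .zig fun a c ⟨b, hab, hbc⟩ => .base ⟨b, .base hab, hbc⟩

theorem dif_relComp_left {α β γ : Type} {R : β → γ → Prop} {T : α → β → Prop}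
    (hT : ∀ b, ∃ a, T a b) (a : α) (c : γ) :
    Dif (relComp (Dif R) T) a c ↔ Dif (relComp R T) a c := by
  constructor
  · refine Dif.le .zig ?_
    rintro a c ⟨b, hab, hbc⟩
    induction hbc generalizing a with
    | base h => exact .base ⟨_, hab, h⟩
    | zig _ _ _ h₁ h₂ h₃ =>
      obtain ⟨a', ha'⟩ := hT _
      exact .zig (h₁ _ hab) (h₂ _ ha') (h₃ _ ha')
  · exact Dif.le .zig fun a c ⟨b, hab, hbc⟩ => .base ⟨b, hab, .base hbc⟩

theorem comp_assoc (ξ ζ η : PIStar n) : comp (comp ξ ζ) η = comp ξ (comp ζ η) := by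
  apply hat_injective
  intro a d
  have e₁ : (comp ξ ζ).hat = Dif (relComp ξ.hat ζ.hat) := by ext; exact hat_comp _ _ _ _
  have e₂ : (comp ζ η).hat = Dif (relComp ζ.hat η.hat) := by ext; exact hat_comp _ _ _ _
  rw [hat_comp, hat_comp, e₁, e₂, dif_relComp_left η.hat_surj, dif_relComp_right ξ.hat_total]
  have : relComp (relComp ξ.hat ζ.hat) η.hat = relComp ξ.hat (relComp ζ.hat η.hat) := by
    ext a d
    exact ⟨fun ⟨x, hx, y, hy, hd⟩ => ⟨y, ⟨x, hx, hy⟩, hd⟩,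
      fun ⟨y, ⟨x, hx, hy⟩, hd⟩ => ⟨x, hx, y, hy, hd⟩⟩
  rw [this]

theorem hat_id (a b : Option (Fin n)) : (id n).hat a b ↔ a = b := by
  cases a <;> cases b <;> simp [hat, id, InDom, InCod]

theorem id_comp (ξ : PIStar n) : comp (id n) ξ = ξ := by
  apply hat_injective
  intro a d
  rw [hat_comp]
  have : relComp (id n).hat ξ.hat = ξ.hat := by
    ext a d; simp [relComp, hat_id]
  rw [this]
  exact ⟨Dif.le (U := ξ.hat) ξ.hat_dif fun _ _ h => h, .base⟩

theorem comp_id (ξ : PIStar n) : comp ξ (id n) = ξ := by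
  apply hat_injective
  intro a d
  rw [hat_comp]
  have : relComp ξ.hat (id n).hat = ξ.hat := by
    ext a d; simp [relComp, hat_id]
  rw [this]
  exact ⟨Dif.le (U := ξ.hat) ξ.hat_dif fun _ _ h => h, .base⟩

/-- The monoid `PI_n^*`; the product `ξ * ζ` is "first `ζ`, then `ξ`". -/
instance : Monoid (PIStar n) where
  mul := comp
  one := id n
  mul_assoc := comp_assoc
  one_mul := id_comp
  mul_one := comp_id

end PIStar

/-- A set partition of a subset of `Fin n` into `k` parts, together with a linear ordering
`part 0, …, part (k-1)` of its parts. -/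
structure OrderedPartition (n k : ℕ) where
  part : Fin k → Set (Fin n)
  nonempty : ∀ i, (part i).Nonempty
  disjoint : ∀ i j, i ≠ j → Disjoint (part i) (part j)

namespace OrderedPartition

variable {n k : ℕ}

theorem eq_of_mem (P : OrderedPartition n k) {i j : Fin k} {a : Fin n} (hi : a ∈ P.part i)
    (hj : a ∈ P.part j) : i = j := by
  by_contra h
  exact Set.disjoint_left.1 (P.disjoint i j h) hi hj

/-- The element of `PI_n^*` that sends the `i`-th part of `P` to the `s i`-th part of `P`. -/
def permute (P : OrderedPartition n k) (s : Equiv.Perm (Fin k)) : PIStar n where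
  rel a b := ∃ i, a ∈ P.part i ∧ b ∈ P.part (s i)
  difunctional := by
    rintro a b c d ⟨i, hi, hi'⟩ ⟨j, hj, hj'⟩ ⟨j', hj'', hd⟩
    obtain rfl := P.eq_of_mem hj hj''
    obtain rfl := s.injective (P.eq_of_mem hi' hj')
    exact ⟨i, hi, hd⟩

theorem conn_permute (P : OrderedPartition n k) (s t : Equiv.Perm (Fin k)) {x y : Fin n}
    (h : PIStar.Conn (P.permute s) (P.permute t) x y) (i : Fin k) :
    x ∈ P.part i ↔ y ∈ P.part i := by
  induction h with
  | rel x y h =>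
    rcases h with ⟨a, ⟨j, hj, hx⟩, ⟨j', hj', hy⟩⟩ | ⟨b, ⟨j, hx, hj⟩, ⟨j', hy, hj'⟩⟩
    · obtain rfl := P.eq_of_mem hj hj'
      exact ⟨fun h => P.eq_of_mem hx h ▸ hy, fun h => P.eq_of_mem hy h ▸ hx⟩
    · obtain rfl := s.injective (P.eq_of_mem hj hj')
      exact ⟨fun h => P.eq_of_mem hx h ▸ hy, fun h => P.eq_of_mem hy h ▸ hx⟩
  | refl => rfl
  | symm _ _ _ ih => exact ih.symm
  | trans _ _ _ _ _ ih₁ ih₂ => exact ih₁.trans ih₂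

/-- The symmetric group `S_k`, embedded in `PI_n^*` as the group of all permutations of the parts
of `P`, that is, as the maximal subgroup at the idempotent `P.toMaxSubgroup 1`, which is the
identity map on the set of parts of `P`. -/
def toMaxSubgroup (P : OrderedPartition n k) : Equiv.Perm (Fin k) →ₙ* PIStar n where
  toFun := P.permute
  map_mul' s t := by
    ext a d
    constructor
    · rintro ⟨i, hi, hd⟩
      obtain ⟨x, hx⟩ := P.nonempty (t i)
      refine ⟨x, x, ⟨i, hi, hx⟩, .refl x, fun y hxy => ?_, ⟨t i, hx, hd⟩⟩
      have hy := (P.conn_permute s t hxy (t i)).1 hx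
      exact ⟨⟨a, i, hi, hy⟩, ⟨d, t i, hy, hd⟩⟩
    · rintro ⟨x, y, ⟨i, hi, hx⟩, hxy, -, ⟨j, hy, hd⟩⟩
      obtain rfl := P.eq_of_mem ((P.conn_permute s t hxy (t i)).1 hx) hy
      exact ⟨i, hi, hd⟩

end OrderedPartition

/-- The `PI_n^*`-module `N^lam = 𝕜[L_P] ⊗_{𝕜[S_k]} S^lam`, where `P` is a set partition of a subset
of `Fin n` with `k` parts, `L_P` is the left cell of the identity map on the set of parts of `P`,
and `lam` is a partition of `k`. -/
noncomputable def simpleN (𝕜 : Type*) [Field 𝕜] {n k : ℕ} (P : OrderedPartition n k)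
    (lam : YoungDiagram) :
    Representation 𝕜 (PIStar n) (CellIndSpace P.toMaxSubgroup (specht 𝕜 lam k)) :=
  cellInd P.toMaxSubgroup (specht 𝕜 lam k)

end PIStar

/-! ### The 0/1-matrices -/

section Matrices

/-- `Q̃_{k,l}^m`: the `0/1`-matrices (`true` is `1`) with rows indexed by `{0,…,k}` and columns
indexed by `{0,…,l}`, where `none` is the index `0` and `some i` are the positive indices, with
`(0,0)`-entry `0`, exactly `m` entries `1`, and no zero row or column of positive index. -/
structure QTilde (k l m : ℕ) where
  mat : Matrix (Option (Fin k)) (Option (Fin l)) Bool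
  zero_zero : mat none none = false
  card_ones : Nat.card {p : Option (Fin k) × Option (Fin l) // mat p.1 p.2 = true} = m
  row_ne_zero : ∀ i : Fin k, ∃ j, mat (some i) j = true
  col_ne_zero : ∀ j : Fin l, ∃ i, mat i (some j) = true

namespace QTilde

variable {k l m : ℕ}

/-- The set of `1`-entries of `M`. -/
abbrev Ones (M : QTilde k l m) : Type :=
  {p : Option (Fin k) × Option (Fin l) // M.mat p.1 p.2 = true}

theorem mat_injective : Function.Injective (QTilde.mat (k := k) (l := l) (m := m)) := by
  rintro ⟨A, _, _, _, _⟩ ⟨B, _, _, _, _⟩ h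
  cases h
  rfl

/-- `(s, t) ∈ S_k × S_l` moves the entry in position `(i, j)` to position `(s i, t j)`. -/
def posPerm : Equiv.Perm (Fin k) × Equiv.Perm (Fin l) →*
    Equiv.Perm (Option (Fin k) × Option (Fin l)) where
  toFun g := Equiv.prodCongr (Equiv.optionCongr g.1) (Equiv.optionCongr g.2)
  map_one' := by ext1 ⟨i, j⟩; cases i <;> cases j <;> rfl
  map_mul' g h := by ext1 ⟨i, j⟩; cases i <;> cases j <;> rfl

/-- The action of `G = S_k × S_l` by permutation of the rows and columns of positive index. -/
instance : MulAction (Equiv.Perm (Fin k) × Equiv.Perm (Fin l)) (QTilde k l m) where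
  smul g M :=
    { mat := fun i j => M.mat (posPerm g⁻¹ (i, j)).1 (posPerm g⁻¹ (i, j)).2
      zero_zero := M.zero_zero
      card_ones :=
        (Nat.card_congr ((posPerm g⁻¹).subtypeEquiv fun _ => Iff.rfl)).trans M.card_ones
      row_ne_zero := fun i => by
        obtain ⟨j, hj⟩ := M.row_ne_zero (g.1⁻¹ i)
        refine ⟨Equiv.optionCongr g.2 j, ?_⟩
        cases j <;> simpa [posPerm] using hj
      col_ne_zero := fun j => by
        obtain ⟨i, hi⟩ := M.col_ne_zero (g.2⁻¹ j)
        refine ⟨Equiv.optionCongr g.1 i, ?_⟩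
        cases i <;> simpa [posPerm] using hi }
  one_smul M := by
    apply mat_injective
    ext i j
    change M.mat (posPerm 1⁻¹ (i, j)).1 (posPerm 1⁻¹ (i, j)).2 = _
    rw [inv_one, map_one]; rfl
  mul_smul g h M := by
    apply mat_injective
    ext i j
    change M.mat (posPerm (g * h)⁻¹ (i, j)).1 (posPerm (g * h)⁻¹ (i, j)).2 =
      M.mat (posPerm h⁻¹ (posPerm g⁻¹ (i, j))).1 (posPerm h⁻¹ (posPerm g⁻¹ (i, j))).2
    rw [mul_inv_rev, map_mul]; rfl

theorem smul_mat (g : Equiv.Perm (Fin k) × Equiv.Perm (Fin l)) (M : QTilde k l m)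
    (p : Option (Fin k) × Option (Fin l)) :
    (g • M).mat (posPerm g p).1 (posPerm g p).2 = M.mat p.1 p.2 := by
  change M.mat (posPerm g⁻¹ (posPerm g p)).1 (posPerm g⁻¹ (posPerm g p)).2 = _
  rw [← Equiv.Perm.mul_apply, ← map_mul, inv_mul_cancel, map_one]; rfl

/-- The stabilizer `H` of `M` in `G = S_k × S_l`. -/
abbrev stab (M : QTilde k l m) : Subgroup (Equiv.Perm (Fin k) × Equiv.Perm (Fin l)) :=
  MulAction.stabilizer (Equiv.Perm (Fin k) × Equiv.Perm (Fin l)) M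

/-- The homomorphism from `H` to the group of permutations of the `1`-entries of `M`. -/
def stabToOnes (M : QTilde k l m) : M.stab →* Equiv.Perm M.Ones where
  toFun h := (posPerm h.1).subtypeEquiv fun p => by
    have h1 := smul_mat h.1 M p
    rw [MulAction.mem_stabilizer_iff.1 h.2] at h1
    rw [h1]
  map_one' := by
    ext1 p
    apply Subtype.ext
    change posPerm (1 : Equiv.Perm (Fin k) × Equiv.Perm (Fin l)) p.1 = p.1
    rw [map_one]; rfl
  map_mul' g h := by
    ext1 p
    apply Subtype.ext
    change posPerm (g.1 * h.1) p.1 = posPerm g.1 (posPerm h.1 p.1)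
    rw [map_mul]; rfl

/-- The homomorphism `H → S_m` obtained from a bijection `ψ` between `Fin m` and the `1`-entries
of `M`. It is injective, and identifies `H` with a subgroup of `S_m`. -/
def stabToPerm (M : QTilde k l m) (ψ : Fin m ≃ M.Ones) : M.stab →* Equiv.Perm (Fin m) :=
  ψ.symm.permCongrHom.toMonoidHom.comp M.stabToOnes

/-- The multiplicity `[Ind_H^{S_m} Res_H^G (S^lam ⊗ S^mu) : S^nu]`, where `H` is the stabilizer of
`M` in `G = S_k × S_l`, regarded as a subgroup of `S_m` by means of `ψ`. -/
noncomputable def indResMultiplicity (𝕜 : Type*) [Field 𝕜] (M : QTilde k l m)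
    (ψ : Fin m ≃ M.Ones) (lam mu nu : YoungDiagram) : ℕ :=
  repMultiplicity
    (Representation.ind (M.stabToPerm ψ)
      ((extTensor (specht 𝕜 lam k) (specht 𝕜 mu l)).comp M.stab.subtype))
    (specht 𝕜 nu m)

end QTilde

/-- `C` is a cross-section of the set of orbits of `G` on `X`: it contains exactly one element of
each orbit. -/
def IsCrossSection (G : Type*) {X : Type*} [Group G] [MulAction G X] (C : Finset X) : Prop :=
  ∀ x : X, ∃! y, y ∈ C ∧ y ∈ MulAction.orbit G x

end Matrices

/-! Every module in the formula is replaced by a space of equivariant functions, on which the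
decomposition of `N^lam ⊗ N^mu` becomes visible. An element of `PI_n^*` acts by a partial injection
on the colorings of subsets of `Fin n` that use all of `k` colors, and this commutes with the
permutations of the colors. The left cell of an ordered partition is the set of these colorings,
with right multiplication by `S_k` turned into recoloring. Since the order of `S_k` is invertible,
coinvariants can be replaced by equivariant functions, so `N^lam` is the module of `S_k`-equivariant
functions from colorings to the Specht module (`OrderedPartition.simpleNEquiv`), and `N^lam ⊗ N^mu`
consists of the `S_k × S_l`-equivariant functions on pairs of colorings
(`PartialAction.tensorEquiv`).

A pair of colorings gives each point a pair of colors. The pairs other than `(none, none)` that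
occur are the `1`-entries of a matrix `M` in some `Q̃_{k,l}^m`, and the pair of colorings amounts to
`M` together with a coloring by the `m` entries of `M`. The monoid preserves `M` and acts on the
second datum only. Equivariant functions on pairs therefore split over the orbits of matrices. For
one `M` there remain `H_M`-equivariant functions on colorings with `m` colors; these are the
`S_m`-equivariant functions with values in the `H_M`-equivariant functions on `S_m`, which form the
induced representation (`QTilde.nonempty_equiv_piRep`, `TranslationSet.indEquiv`).

Passing from a representation of `S_m` to the equivariant functions on colorings with `m` colors
respects products, preserves irreducibility and reflects isomorphism, and different `m` give
nonisomorphic modules (`Coloring.transporting`, `Coloring.not_nonempty_equiv`). The reason is that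
some element of the monoid carries one given coloring to another and is undefined outside the orbit
of the first and on all colorings with more colors. Once the induced representations are decomposed
by Maschke's theorem, both sides of the formula count the same summands
(`Coloring.repMultiplicity_eq_sum`). -/

/-! ### Multiplicities in direct sums of simple objects -/

section PiMultiplicity

/-- The filtration of a direct sum by the numbers of nonzero coordinates. -/
def coordinateFiltration {R M : Type*} [Ring R] [AddCommGroup M] [Module R M] {r : ℕ}
    {T : Fin r → Type*} [∀ i, AddCommGroup (T i)] [∀ i, Module R (T i)]
    (e : M ≃ₗ[R] ∀ i, T i) (j : ℕ) : Submodule R M where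
  carrier := {x | ∀ i : Fin r, j ≤ i → e x i = 0}
  add_mem' hx hy i hi := by simp [hx i hi, hy i hi]
  zero_mem' i _ := by simp
  smul_mem' c x hx i hi := by simp [hx i hi]

theorem coordinateFiltration_mono {R M : Type*} [Ring R] [AddCommGroup M] [Module R M] {r : ℕ}
    {T : Fin r → Type*} [∀ i, AddCommGroup (T i)] [∀ i, Module R (T i)]
    (e : M ≃ₗ[R] ∀ i, T i) : Monotone (coordinateFiltration e) :=
  fun _ _ h _ hx i hi => hx i (h.trans hi)

/-- The factors of the coordinate filtration are the summands. -/
noncomputable def coordinateFiltrationFactor {R M : Type*} [Ring R] [AddCommGroup M] [Module R M]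
    {r : ℕ} {T : Fin r → Type*} [∀ i, AddCommGroup (T i)] [∀ i, Module R (T i)]
    (e : M ≃ₗ[R] ∀ i, T i) (j : Fin r) :
    (↥(coordinateFiltration e (j + 1)) ⧸
      (coordinateFiltration e j).comap (coordinateFiltration e (j + 1)).subtype) ≃ₗ[R] T j :=
  let f : ↥(coordinateFiltration e (j + 1)) →ₗ[R] T j :=
    LinearMap.proj j ∘ₗ e.toLinearMap ∘ₗ (coordinateFiltration e (j + 1)).subtype
  (Submodule.quotEquivOfEq _ (LinearMap.ker f) (by
    ext x
    rw [Submodule.mem_comap, LinearMap.mem_ker]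
    refine ⟨fun h => h j le_rfl, fun h i hi => ?_⟩
    rcases hi.eq_or_lt with h' | h'
    · rw [← Fin.ext h']; exact h
    · exact x.2 i h')).trans
  (f.quotKerEquivOfSurjective fun t => by
    classical
    refine ⟨⟨e.symm (Pi.single j t), fun i hi => ?_⟩, ?_⟩
    · rw [LinearEquiv.apply_symm_apply, Pi.single_eq_of_ne]
      rintro rfl
      omega
    · simp [f])

/-- The factors of the coordinate filtration are the simple modules `T i`, so it is a composition
series, and by Jordan–Hölder any composition series may be used for the count. -/
theorem moduleMultiplicity_of_fin_pi {R M : Type*} [Ring R] [AddCommGroup M] [Module R M]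
    {r : ℕ} {T : Fin r → Type*} [∀ i, AddCommGroup (T i)] [∀ i, Module R (T i)]
    [∀ i, IsSimpleModule R (T i)] (e : M ≃ₗ[R] ∀ i, T i)
    (S : Type*) [AddCommGroup S] [Module R S] :
    moduleMultiplicity R M S = Nat.card {i // Nonempty (T i ≃ₗ[R] S)} := by
  let c : CompositionSeries (Submodule R M) :=
    { length := r
      toFun := fun j => coordinateFiltration e j
      step := fun i => by
        refine (covBy_iff_quot_is_simple (coordinateFiltration_mono e ?_)).2 ?_
        · simp
        · exact IsSimpleModule.congr (coordinateFiltrationFactor e i) }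
  rw [moduleMultiplicity_eq_factorCount R M S c]
  · refine Nat.card_congr (Equiv.subtypeEquivRight fun i => ?_)
    exact ⟨fun ⟨g⟩ => ⟨(coordinateFiltrationFactor e i).symm.trans g⟩,
      fun ⟨g⟩ => ⟨(coordinateFiltrationFactor e i).trans g⟩⟩
  · rw [eq_bot_iff]
    intro x hx
    rw [Submodule.mem_bot, ← e.map_eq_zero_iff]
    ext i
    exact hx i (Nat.zero_le _)
  · rw [eq_top_iff]
    intro x _ i hi
    exact absurd i.2 (not_lt.2 hi)

theorem moduleMultiplicity_of_pi {R M ι : Type*} [Finite ι] [Ring R] [AddCommGroup M]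
    [Module R M] {T : ι → Type*} [∀ i, AddCommGroup (T i)] [∀ i, Module R (T i)]
    [∀ i, IsSimpleModule R (T i)] (e : M ≃ₗ[R] ∀ i, T i)
    (S : Type*) [AddCommGroup S] [Module R S] :
    moduleMultiplicity R M S = Nat.card {i // Nonempty (T i ≃ₗ[R] S)} := by
  obtain ⟨r, ⟨f⟩⟩ := Finite.exists_equiv_fin ι
  rw [moduleMultiplicity_of_fin_pi (e.trans (LinearEquiv.piCongrLeft R T f.symm).symm) S]
  exact Nat.card_congr (f.symm.subtypeEquiv fun _ => Iff.rfl)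

end PiMultiplicity

/-! ### Products of representations and complete reducibility -/

namespace Representation

variable {𝕜 G V W ι : Type*} [Field 𝕜] [Monoid G] [AddCommGroup V] [Module 𝕜 V]
  [AddCommGroup W] [Module 𝕜 W]

/-- The product of a family of representations. -/
def piRep {T : ι → Type*} [∀ i, AddCommGroup (T i)] [∀ i, Module 𝕜 (T i)]
    (τ : ∀ i, Representation 𝕜 G (T i)) : Representation 𝕜 G (∀ i, T i) where
  toFun g := LinearMap.pi fun i => τ i g ∘ₗ LinearMap.proj i
  map_one' := by ext; simp
  map_mul' g h := by ext; simp

/-- Products of isomorphisms are isomorphisms. -/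
noncomputable def piRepCongr {T T' : ι → Type*} [∀ i, AddCommGroup (T i)] [∀ i, Module 𝕜 (T i)]
    [∀ i, AddCommGroup (T' i)] [∀ i, Module 𝕜 (T' i)]
    {τ : ∀ i, Representation 𝕜 G (T i)} {τ' : ∀ i, Representation 𝕜 G (T' i)}
    (e : ∀ i, (τ i).Equiv (τ' i)) : (piRep τ).Equiv (piRep τ') :=
  .mk (LinearEquiv.piCongrRight fun i => (e i).toLinearEquiv) fun g => by
    ext v i
    exact IntertwiningMap.isIntertwining _ _ (e i).toIntertwiningMap g (v i)

/-- A product of products is a product. -/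
def piRepSigma {κ : ι → Type*} {T : ∀ i, κ i → Type*} [∀ i j, AddCommGroup (T i j)]
    [∀ i j, Module 𝕜 (T i j)] (τ : ∀ i j, Representation 𝕜 G (T i j)) :
    (piRep fun i => piRep (τ i)).Equiv (piRep fun x : Σ i, κ i => τ x.1 x.2) :=
  .mk
    { toFun := fun v x => v x.1 x.2
      invFun := fun v i j => v ⟨i, j⟩
      map_add' := fun _ _ => rfl
      map_smul' := fun _ _ => rfl
      left_inv := fun _ => rfl
      right_inv := fun _ => rfl } fun _ => rfl

/-- Representations are isomorphic iff the corresponding modules are. -/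
theorem nonempty_asModule_equiv_iff {ρ : Representation 𝕜 G V} {σ : Representation 𝕜 G W} :
    Nonempty (ρ.asModule ≃ₗ[MonoidAlgebra 𝕜 G] σ.asModule) ↔ Nonempty (ρ.Equiv σ) := by
  constructor
  · rintro ⟨e⟩
    exact ⟨IntertwiningMap.ofBijective
      ((IntertwiningMap.equivLinearMapAsModule ρ σ).symm e.toLinearMap) e.bijective⟩
  · rintro ⟨e⟩
    exact ⟨.ofBijective (IntertwiningMap.equivLinearMapAsModule ρ σ e.toIntertwiningMap)
      e.toLinearEquiv.bijective⟩

theorem repMultiplicity_of_pi {U : Type*} [AddCommGroup U] [Module 𝕜 U] [Finite ι]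
    {T : ι → Type*} [∀ i, AddCommGroup (T i)]
    [∀ i, Module 𝕜 (T i)] {τ : ∀ i, Representation 𝕜 G (T i)} (hτ : ∀ i, (τ i).IsIrreducible)
    {ρ : Representation 𝕜 G V} (e : ρ.Equiv (piRep τ)) (σ : Representation 𝕜 G U) :
    repMultiplicity ρ σ = Nat.card {i // Nonempty ((τ i).Equiv σ)} := by
  have : ∀ i, IsSimpleModule (MonoidAlgebra 𝕜 G) (τ i).asModule :=
    fun i => (irreducible_iff_isSimpleModule_asModule _).1 (hτ i)
  let f : ρ.asModule →ₗ[MonoidAlgebra 𝕜 G] ∀ i, (τ i).asModule := LinearMap.pi fun i =>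
    IntertwiningMap.equivLinearMapAsModule ρ (τ i)
      ⟨LinearMap.proj i ∘ₗ e.toLinearEquiv.toLinearMap, fun g => by
        ext v
        exact congrFun (IntertwiningMap.isIntertwining _ _ e.toIntertwiningMap g v) i⟩
  rw [repMultiplicity, moduleMultiplicity_of_pi
    (LinearEquiv.ofBijective f e.toLinearEquiv.bijective)]
  exact Nat.card_congr (Equiv.subtypeEquivRight fun i => nonempty_asModule_equiv_iff)

theorem IsIrreducible.nontrivial {ρ : Representation 𝕜 G V} (h : ρ.IsIrreducible) :
    Nontrivial V := by
  by_contra hV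
  rw [not_nontrivial_iff_subsingleton] at hV
  obtain ⟨N, N', hN⟩ := h.toNontrivial
  refine hN (SetLike.ext fun u => ?_)
  rw [Subsingleton.elim u 0]
  exact ⟨fun _ => N'.toSubmodule.zero_mem, fun _ => N.toSubmodule.zero_mem⟩

/-- **Maschke's theorem**: in characteristic zero, a finite-dimensional representation of a finite group is a
product of irreducible representations. -/
theorem exists_equiv_piRep {G : Type*} [Group G] [Finite G] [CharZero 𝕜] [FiniteDimensional 𝕜 V]
    (ρ : Representation 𝕜 G V) : ∃ (r : ℕ) (S : Fin r → Subrepresentation ρ),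
      (∀ i, (S i).toRepresentation.IsIrreducible) ∧
      Nonempty (ρ.Equiv (piRep fun i => (S i).toRepresentation)) := by
  have : NeZero (Nat.card G : 𝕜) := ⟨by simp [Nat.card_pos.ne']⟩
  have : Module.Finite (MonoidAlgebra 𝕜 G) ρ.asModule := .of_restrictScalars_finite 𝕜 _ _
  obtain ⟨r, N, e, hN⟩ :=
    IsSemisimpleModule.exists_linearEquiv_fin_dfinsupp (MonoidAlgebra 𝕜 G) ρ.asModule
  have e' : ρ.asModule ≃ₗ[MonoidAlgebra 𝕜 G] ∀ i, N i := e.trans DFinsupp.linearEquivFunOnFintype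
  -- `N i` carries two module structures, as a submodule and through its representation. They agree
  -- on the elements of the group, hence on the whole algebra.
  have key : ∀ i (a : MonoidAlgebra 𝕜 G) (x : N i),
      ((Subrepresentation.ofSubmodule' (N i)).toRepresentation.asAlgebraHom a x).1 = a • x.1 := by
    intro i a x
    induction a using MonoidAlgebra.induction_linear with
    | zero => rw [map_zero, zero_smul]; rfl
    | add a b ha hb => rw [map_add, add_smul, ← ha, ← hb]; rfl
    | single g c => rw [asAlgebraHom_single, single_smul]; rfl
  refine ⟨r, fun i => .ofSubmodule' (N i), fun i => ?_, ⟨.mk (e'.restrictScalars 𝕜) fun g => ?_⟩⟩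
  · rw [irreducible_iff_isSimpleModule_asModule]
    have := hN i
    let f : N i →ₗ[MonoidAlgebra 𝕜 G]
        (Subrepresentation.ofSubmodule' (N i)).toRepresentation.asModule :=
      { toFun := fun x => x
        map_add' := fun _ _ => rfl
        map_smul' := fun a x => Subtype.ext (key i a x).symm }
    exact IsSimpleModule.congr (LinearEquiv.ofBijective f Function.bijective_id).symm
  · ext v i : 2
    let v' : ρ.asModule := v
    have h0 : MonoidAlgebra.single g (1 : 𝕜) • v' = ρ g v := by
      rw [single_smul, one_smul]; rfl
    have h1 := congrFun (e'.map_smul (MonoidAlgebra.single g (1 : 𝕜)) v') i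
    rw [h0] at h1
    refine h1.trans (Subtype.ext ?_)
    refine (key i _ _).symm.trans ?_
    rw [asAlgebraHom_single, one_smul]
    rfl

/-- One decomposition of `ρ` into irreducibles serves both sides, so no composition series has to be
transported along `e`. -/
theorem repMultiplicity_congr_left {G W' : Type*} [Group G] [Finite G] [CharZero 𝕜]
    [AddCommGroup W'] [Module 𝕜 W'] [FiniteDimensional 𝕜 V] {ρ : Representation 𝕜 G V}
    {ρ' : Representation 𝕜 G W'} (e : ρ'.Equiv ρ) (σ : Representation 𝕜 G W) :
    repMultiplicity ρ' σ = repMultiplicity ρ σ := by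
  obtain ⟨r, S, hS, ⟨f⟩⟩ := ρ.exists_equiv_piRep
  rw [repMultiplicity_of_pi hS f, repMultiplicity_of_pi hS (e.trans f)]

theorem repMultiplicity_congr_right {W' : Type*} [AddCommGroup W'] [Module 𝕜 W']
    (ρ : Representation 𝕜 G V) {σ : Representation 𝕜 G W} {σ' : Representation 𝕜 G W'}
    (e : σ.Equiv σ') : repMultiplicity ρ σ = repMultiplicity ρ σ' := by
  obtain ⟨f⟩ := nonempty_asModule_equiv_iff.2 ⟨e⟩
  unfold repMultiplicity moduleMultiplicity
  split_ifs with h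
  · exact Nat.card_congr (Equiv.subtypeEquivRight fun i =>
      ⟨fun ⟨g⟩ => ⟨g.trans f⟩, fun ⟨g⟩ => ⟨g.trans f.symm⟩⟩)
  · rfl

/-- Tensor products of isomorphisms are isomorphisms. -/
noncomputable def tprodCongr {V' W' : Type*} [AddCommGroup V'] [Module 𝕜 V'] [AddCommGroup W']
    [Module 𝕜 W'] {ρ : Representation 𝕜 G V} {ρ' : Representation 𝕜 G V'}
    {σ : Representation 𝕜 G W} {σ' : Representation 𝕜 G W'} (e : ρ.Equiv ρ') (f : σ.Equiv σ') :
    (ρ.tprod σ).Equiv (ρ'.tprod σ') :=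
  .mk (TensorProduct.congr e.toLinearEquiv f.toLinearEquiv) fun g => by
    ext x y : 3
    exact congrArg₂ (· ⊗ₜ ·)
      (IntertwiningMap.isIntertwining _ _ e.toIntertwiningMap g x)
      (IntertwiningMap.isIntertwining _ _ f.toIntertwiningMap g y)

end Representation

/-! ### Partial actions of monoids and equivariant functions -/

/-- An action of the monoid `M` on `X` by partial injections that commute with the action of the
group `G`: `Rel a x y` means that `a` sends `x` to `y`. -/
structure PartialAction (M G X : Type*) [Monoid M] [Group G] [MulAction G X] where
  Rel : M → X → X → Prop
  right_unique : ∀ {a x y y'}, Rel a x y → Rel a x y' → y = y'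
  left_unique : ∀ {a x x' y}, Rel a x y → Rel a x' y → x = x'
  rel_one : ∀ {x y}, Rel 1 x y ↔ x = y
  rel_mul : ∀ {a b x z}, Rel (a * b) x z ↔ ∃ y, Rel b x y ∧ Rel a y z
  rel_smul : ∀ {a x y} (g : G), Rel a x y → Rel a (g • x) (g • y)

/-- The space of equivariant functions from a `G`-set to a representation of `G`. -/
def equivariantFunctions {𝕜 G U : Type*} (X : Type*) [Field 𝕜] [Group G] [MulAction G X]
    [AddCommGroup U] [Module 𝕜 U] (σ : Representation 𝕜 G U) : Submodule 𝕜 (X → U) where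
  carrier := {f | ∀ (g : G) x, f (g • x) = σ g (f x)}
  add_mem' hf hf' g x := by simp [hf g x, hf' g x]
  zero_mem' g x := by simp
  smul_mem' c f hf g x := by simp [hf g x]

namespace PartialAction

variable {𝕜 M G X U W : Type*} [Field 𝕜] [Monoid M] [Group G] [MulAction G X]
  [AddCommGroup U] [Module 𝕜 U] [AddCommGroup W] [Module 𝕜 W]
  (R : PartialAction M G X) (σ : Representation 𝕜 G U) {τ : Representation 𝕜 G W}

theorem rel_smul_iff {a : M} {x y : X} (g : G) : R.Rel a (g • x) (g • y) ↔ R.Rel a x y :=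
  ⟨fun h => by simpa using R.rel_smul g⁻¹ h, R.rel_smul g⟩

open Classical in
/-- The action of an element of `M` on functions. -/
noncomputable def act (a : M) (f : X → U) (y : X) : U :=
  if h : ∃ x, R.Rel a x y then f h.choose else 0

theorem act_of_rel {a : M} {x y : X} (h : R.Rel a x y) (f : X → U) : R.act a f y = f x := by
  have h' : ∃ x, R.Rel a x y := ⟨x, h⟩
  rw [act, dif_pos h', R.left_unique h'.choose_spec h]

theorem act_of_forall_not {a : M} {y : X} (h : ∀ x, ¬ R.Rel a x y) (f : X → U) :
    R.act a f y = 0 :=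
  dif_neg fun ⟨x, hx⟩ => h x hx

/-- The preimage `x` does not depend on the function, which allows several functions to be treated
in one case distinction. -/
theorem act_cases (a : M) (y : X) : (∃ x, R.Rel a x y ∧ ∀ f : X → U, R.act a f y = f x) ∨
    ((∀ x, ¬ R.Rel a x y) ∧ ∀ f : X → U, R.act a f y = 0) := by
  by_cases h : ∃ x, R.Rel a x y
  · obtain ⟨x, hx⟩ := h
    exact Or.inl ⟨x, hx, fun f => R.act_of_rel hx f⟩
  · push Not at h
    exact Or.inr ⟨h, fun f => R.act_of_forall_not h f⟩

/-- The representation of `M` on the space of equivariant functions. -/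
noncomputable def rep : Representation 𝕜 M (equivariantFunctions X σ) where
  toFun a :=
    { toFun := fun f => ⟨R.act a f.1, fun g y => by
        rcases R.act_cases (U := U) a y with ⟨x, hx, h⟩ | ⟨hy, h⟩
        · rw [h, R.act_of_rel (R.rel_smul g hx), f.2]
        · rw [h, map_zero, R.act_of_forall_not]
          intro x hx
          exact hy (g⁻¹ • x) ((R.rel_smul_iff g).1 (by simpa using hx))⟩
      map_add' := fun f f' => by
        ext y
        change R.act a (f.1 + f'.1) y = R.act a f.1 y + R.act a f'.1 y
        rcases R.act_cases (U := U) a y with ⟨x, hx, h⟩ | ⟨hy, h⟩ <;> simp [h]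
      map_smul' := fun c f => by
        ext y
        change R.act a (c • f.1) y = c • R.act a f.1 y
        rcases R.act_cases (U := U) a y with ⟨x, hx, h⟩ | ⟨hy, h⟩ <;> simp [h] }
  map_one' := by
    ext f y
    exact R.act_of_rel (R.rel_one.2 rfl) f.1
  map_mul' a b := by
    ext f z
    change R.act (a * b) f.1 z = R.act a (R.act b f.1) z
    rcases R.act_cases (U := U) a z with ⟨y, hy, h⟩ | ⟨hz, h⟩
    · rw [h]
      rcases R.act_cases (U := U) b y with ⟨x, hx, h'⟩ | ⟨hx, h'⟩
      · rw [h', R.act_of_rel (R.rel_mul.2 ⟨y, hx, hy⟩)]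
      · rw [h', R.act_of_forall_not]
        rintro x hxz
        obtain ⟨y', hxy', hy'⟩ := R.rel_mul.1 hxz
        exact hx x (R.left_unique hy hy' ▸ hxy')
    · rw [h, R.act_of_forall_not]
      rintro x hxz
      obtain ⟨y', hxy', hy'⟩ := R.rel_mul.1 hxz
      exact hz y' hy'

theorem rep_apply (a : M) (f : equivariantFunctions X σ) (y : X) :
    (R.rep σ a f).1 y = R.act a f.1 y := rfl

/-- An isomorphism of coefficients induces an isomorphism. -/
noncomputable def repCongr {σ : Representation 𝕜 G U} (e : σ.Equiv τ) :
    (R.rep σ).Equiv (R.rep τ) :=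
  .mk
    { toFun := fun f => ⟨fun x => e (f.1 x), fun g x => by
        beta_reduce
        rw [f.2]
        exact Representation.IntertwiningMap.isIntertwining _ _ e.toIntertwiningMap g _⟩
      map_add' := fun _ _ => by ext x; exact map_add e.toLinearEquiv _ _
      map_smul' := fun _ _ => by ext x; exact map_smul e.toLinearEquiv _ _
      invFun := fun f => ⟨fun x => e.symm (f.1 x), fun g x => by
        beta_reduce
        rw [f.2]
        exact Representation.IntertwiningMap.isIntertwining _ _ e.symm.toIntertwiningMap g _⟩
      left_inv := fun f => by ext x; exact e.symm_apply_apply _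
      right_inv := fun f => by ext x; exact e.apply_symm_apply _ } fun a => by
    ext f y
    change e (R.act a f.1 y) = R.act a _ y
    rcases R.act_cases (U := U) a y with ⟨x, hx, h⟩ | ⟨hy, h⟩
    · rw [h, R.act_of_rel hx]
      rfl
    · rw [h, R.act_of_forall_not hy]
      exact map_zero e.toLinearEquiv

/-- Equivariant functions with values in a product. -/
noncomputable def repPi {ι : Type*} {T : ι → Type*} [∀ i, AddCommGroup (T i)]
    [∀ i, Module 𝕜 (T i)] (τ : ∀ i, Representation 𝕜 G (T i)) :
    (R.rep (Representation.piRep τ)).Equiv (Representation.piRep fun i => R.rep (τ i)) :=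
  .mk
    { toFun := fun f i => ⟨fun x => f.1 x i, fun g x => by beta_reduce; rw [f.2]; rfl⟩
      map_add' := fun _ _ => rfl
      map_smul' := fun _ _ => rfl
      invFun := fun f => ⟨fun x i => (f i).1 x, fun g x => by
        ext i
        exact (f i).2 g x⟩
      left_inv := fun _ => rfl
      right_inv := fun _ => rfl } fun a => by
    ext f i y
    change R.act a f.1 y i = R.act a (fun x => f.1 x i) y
    rcases R.act_cases (U := ∀ i, T i) a y with ⟨x, hx, h⟩ | ⟨hy, h⟩
    · rw [h, R.act_of_rel hx]
    · rw [h, R.act_of_forall_not hy]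
      rfl

/-! ### Equivariant functions supported on one orbit -/

section Delta

variable [Fintype G]

open Classical in
/-- The equivariant function supported on the orbit of `x` whose value at `x` is the sum of all
`g u`, where `g` runs over the stabilizer of `x`. -/
noncomputable def delta (x : X) : U →ₗ[𝕜] equivariantFunctions X σ where
  toFun u := ⟨fun y => ∑ g : G, if g • x = y then σ g u else 0, fun g y => by
    rw [map_sum]
    refine Fintype.sum_equiv (Equiv.mulLeft g⁻¹) _ _ fun h => ?_
    have : (Equiv.mulLeft g⁻¹) h • x = y ↔ h • x = g • y := by
      rw [Equiv.coe_mulLeft, mul_smul, inv_smul_eq_iff]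
    by_cases hx : h • x = g • y
    · rw [if_pos hx, if_pos (this.2 hx), ← Module.End.mul_apply, ← map_mul, Equiv.coe_mulLeft,
        mul_inv_cancel_left]
    · rw [if_neg hx, if_neg (fun h => hx (this.1 h)), map_zero]⟩
  map_add' u v := by
    ext y
    simp only [map_add, Submodule.coe_add, Pi.add_apply, ← Finset.sum_add_distrib]
    exact Finset.sum_congr rfl fun g _ => by split_ifs <;> simp
  map_smul' c u := by
    ext y
    simp only [map_smul, Submodule.coe_smul, Pi.smul_apply, Finset.smul_sum, RingHom.id_apply]
    exact Finset.sum_congr rfl fun g _ => by split_ifs <;> simp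

open Classical in
theorem delta_apply (x y : X) (u : U) :
    (delta σ x u).1 y = ∑ g : G, if g • x = y then σ g u else 0 := rfl

/-- This is the relation by which `x ⊗ u ↦ delta σ x u` factors through the coinvariants. -/
theorem delta_smul (g : G) (x : X) (u : U) : delta σ (g • x) (σ g u) = delta σ x u := by
  classical
  ext y
  rw [delta_apply, delta_apply]
  refine Fintype.sum_equiv (Equiv.mulRight g) _ _ fun h => ?_
  rw [Equiv.coe_mulRight, mul_smul, map_mul, Module.End.mul_apply]

theorem delta_apply_of_forall_ne {x y : X} (h : ∀ g : G, g • x ≠ y) (u : U) :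
    (delta σ x u).1 y = 0 :=
  Finset.sum_eq_zero fun g _ => if_neg (h g)

theorem delta_apply_smul_of_free (hX : ∀ (g : G) (x : X), g • x = x → g = 1) (x : X) (g : G)
    (u : U) : (delta σ x u).1 (g • x) = σ g u := by
  classical
  rw [delta_apply, Finset.sum_eq_single g]
  · rw [if_pos rfl]
  · intro h _ hne
    rw [if_neg]
    intro hg
    refine hne (inv_mul_eq_one.1 (hX (g⁻¹ * h) x ?_)).symm
    rw [mul_smul, hg, inv_smul_smul]
  · simp

theorem delta_apply_self_of_free (hX : ∀ (g : G) (x : X), g • x = x → g = 1) (x : X) (u : U) :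
    (delta σ x u).1 x = u := by
  simpa using delta_apply_smul_of_free σ hX x 1 u

/-- At `y`, each `g` contributes through `x = g⁻¹ y` alone, and the contribution `σ g (f (g⁻¹ y))`
is `f y`. After division by the order of `G`, every equivariant function is thus an explicit sum of
functions `delta`. -/
theorem sum_delta [Fintype X] (f : equivariantFunctions X σ) :
    ∑ x, delta σ x (f.1 x) = (Fintype.card G : 𝕜) • f := by
  classical
  ext y
  simp only [AddSubmonoidClass.coe_finsetSum, Finset.sum_apply, delta_apply, Submodule.coe_smul,
    Pi.smul_apply]
  rw [Finset.sum_comm]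
  have : ∀ g : G, (∑ x, if g • x = y then σ g (f.1 x) else 0) = f.1 y := fun g => by
    rw [Finset.sum_eq_single (g⁻¹ • y)]
    · rw [if_pos (smul_inv_smul g y), ← f.2, smul_inv_smul]
    · intro x _ hx
      rw [if_neg]
      rintro rfl
      exact hx (inv_smul_smul g x).symm
    · simp
  simp [this, Nat.cast_smul_eq_nsmul]

/-- Since `a` is a partial injection that commutes with `G`, it matches `g • x` with `g • x'` for
every `g`, so the two sums agree term by term. -/
theorem rep_delta_of_rel {a : M} {x x' : X} (h : R.Rel a x x') (u : U) :
    R.rep σ a (delta σ x u) = delta σ x' u := by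
  classical
  ext y
  rw [rep_apply]
  rcases R.act_cases (U := U) a y with ⟨z, hz, h'⟩ | ⟨hy, h'⟩
  · rw [h', delta_apply, delta_apply]
    refine Finset.sum_congr rfl fun g _ => ?_
    have : g • x = z ↔ g • x' = y := by
      constructor
      · rintro rfl
        exact R.right_unique (R.rel_smul g h) hz
      · rintro rfl
        exact R.left_unique (R.rel_smul g h) hz
    simp only [this]
  · rw [h', delta_apply_of_forall_ne]
    rintro g rfl
    exact hy _ (R.rel_smul g h)

theorem rep_delta_of_forall_not {a : M} {x : X} (h : ∀ x', ¬ R.Rel a x x') (u : U) :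
    R.rep σ a (delta σ x u) = 0 := by
  ext y
  rw [rep_apply]
  rcases R.act_cases (U := U) a y with ⟨z, hz, h'⟩ | ⟨hy, h'⟩
  · rw [h', delta_apply_of_forall_ne]
    · rfl
    · rintro g rfl
      exact h (g⁻¹ • y) ((R.rel_smul_iff g).1 (by simpa using hz))
  · rw [h']
    rfl

end Delta

/-! ### Coinvariants as equivariant functions -/

section Coinvariants

variable {V : Type*} [AddCommGroup V] [Module 𝕜 V] {ρ : Representation 𝕜 G V}

/-- If `G` permutes a basis of `V`, then the coinvariants of `V ⊗ U` map to the equivariant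
functions on the basis. -/
noncomputable def coinvariantsToFunctions [Fintype G] (b : Module.Basis X 𝕜 V)
    (hb : ∀ g x, ρ g (b x) = b (g • x)) :
    Representation.Coinvariants (ρ.tprod σ) →ₗ[𝕜] equivariantFunctions X σ :=
  Representation.Coinvariants.lift _ (TensorProduct.lift (b.constr 𝕜 fun x => delta σ x))
    fun g => by
      refine TensorProduct.ext (b.ext fun x => LinearMap.ext fun u => ?_)
      simp [hb, delta_smul]

theorem coinvariantsToFunctions_mk [Fintype G] (b : Module.Basis X 𝕜 V)
    (hb : ∀ g x, ρ g (b x) = b (g • x)) (x : X) (u : U) :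
    coinvariantsToFunctions σ b hb (Representation.Coinvariants.mk _ (b x ⊗ₜ u)) =
      delta σ x u := by
  simp [coinvariantsToFunctions]

theorem coinvariants_hom_ext {Y : Type*} {σ : Representation 𝕜 G U} (b : Module.Basis Y 𝕜 V)
    {f f' : Representation.Coinvariants (ρ.tprod σ) →ₗ[𝕜] W}
    (h : ∀ x u, f (Representation.Coinvariants.mk _ (b x ⊗ₜ u)) =
      f' (Representation.Coinvariants.mk _ (b x ⊗ₜ u))) : f = f' :=
  Representation.Coinvariants.hom_ext
    (TensorProduct.ext (b.ext fun x => LinearMap.ext fun u => h x u))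

/-- If `G` is finite and permutes a basis of `V`, and the order of `G` is invertible, then the
coinvariants of `V ⊗ U` are the equivariant functions on the basis. -/
noncomputable def coinvariantsEquiv [Fintype G] [Fintype X] [CharZero 𝕜] (b : Module.Basis X 𝕜 V)
    (hb : ∀ g x, ρ g (b x) = b (g • x)) (T : Representation 𝕜 M
      (Representation.Coinvariants (ρ.tprod σ)))
    (h₁ : ∀ a x y u, R.Rel a x y → T a (Representation.Coinvariants.mk _ (b x ⊗ₜ u)) =
      Representation.Coinvariants.mk _ (b y ⊗ₜ u))
    (h₀ : ∀ a x u, (∀ y, ¬ R.Rel a x y) →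
      T a (Representation.Coinvariants.mk _ (b x ⊗ₜ u)) = 0) : T.Equiv (R.rep σ) :=
  have hG : (Fintype.card G : 𝕜) ≠ 0 := by simp
  .mk
    -- The inverse sends `f` to the average over `G` of the classes of `x ⊗ f x`. One composite is
    -- the identity by `sum_delta`; in the other, each `g` contributes the class of `g x ⊗ g u`,
    -- which is that of `x ⊗ u`. No freeness is needed.
    (LinearEquiv.ofLinearMap (coinvariantsToFunctions σ b hb)
      ((Fintype.card G : 𝕜)⁻¹ • ∑ x, Representation.Coinvariants.mk (ρ.tprod σ) ∘ₗ
        TensorProduct.mk 𝕜 V U (b x) ∘ₗ LinearMap.proj x ∘ₗ Submodule.subtype _)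
      (by
        ext1 f
        simp only [LinearMap.comp_apply, LinearMap.smul_apply, map_smul, LinearMap.sum_apply,
          map_sum, TensorProduct.mk_apply, LinearMap.proj_apply, Submodule.subtype_apply,
          coinvariantsToFunctions_mk, sum_delta, LinearMap.id_apply]
        rw [inv_smul_smul₀ hG])
      (by
        classical
        refine coinvariants_hom_ext b fun x u => ?_
        simp only [LinearMap.comp_apply, LinearMap.smul_apply, LinearMap.sum_apply,
          TensorProduct.mk_apply, LinearMap.proj_apply, Submodule.subtype_apply,
          coinvariantsToFunctions_mk, LinearMap.id_apply, delta_apply, map_sum]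
        rw [Finset.sum_comm]
        have : ∀ g : G, (∑ y, Representation.Coinvariants.mk (ρ.tprod σ)
            (b y ⊗ₜ[𝕜] if g • x = y then σ g u else 0)) =
            Representation.Coinvariants.mk (ρ.tprod σ) (b x ⊗ₜ[𝕜] u) := fun g => by
          rw [Finset.sum_eq_single (g • x)]
          · rw [if_pos rfl, ← hb]
            exact Representation.Coinvariants.mk_self_apply (ρ.tprod σ) g (b x ⊗ₜ u)
          · intro y _ hy
            rw [if_neg hy.symm, TensorProduct.tmul_zero, map_zero]
          · simp
        simp only [this, Finset.sum_const, Finset.card_univ, ← Nat.cast_smul_eq_nsmul 𝕜]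
        rw [inv_smul_smul₀ hG]))
    fun a => by
      refine coinvariants_hom_ext b fun x u => ?_
      simp only [LinearMap.comp_apply, LinearEquiv.coe_coe, LinearEquiv.coe_ofLinearMap,
        coinvariantsToFunctions_mk]
      by_cases h : ∃ y, R.Rel a x y
      · obtain ⟨y, hy⟩ := h
        rw [h₁ a x y u hy, coinvariantsToFunctions_mk, rep_delta_of_rel R σ hy]
      · push Not at h
        rw [h₀ a x u h, map_zero, rep_delta_of_forall_not R σ h]

end Coinvariants

end PartialAction

/-- The componentwise action of a product of groups on a product. -/
instance MulAction.prodProd {G G' X X' : Type*} [Group G] [Group G'] [MulAction G X]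
    [MulAction G' X'] : MulAction (G × G') (X × X') where
  smul g x := (g.1 • x.1, g.2 • x.2)
  one_smul x := Prod.ext (one_smul G x.1) (one_smul G' x.2)
  mul_smul g h x := Prod.ext (mul_smul g.1 h.1 x.1) (mul_smul g.2 h.2 x.2)

namespace PartialAction

/-! ### Tensor products -/

section Tensor

variable {𝕜 M G G' X X' U U' : Type*} [Field 𝕜] [Monoid M] [Group G] [Group G'] [MulAction G X]
  [MulAction G' X'] [AddCommGroup U] [Module 𝕜 U] [AddCommGroup U'] [Module 𝕜 U']
  (R : PartialAction M G X) (R' : PartialAction M G' X')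
  (σ : Representation 𝕜 G U) (σ' : Representation 𝕜 G' U')

/-- The diagonal partial action on a product. -/
def prod : PartialAction M (G × G') (X × X') where
  Rel a x y := R.Rel a x.1 y.1 ∧ R'.Rel a x.2 y.2
  right_unique h h' := Prod.ext (R.right_unique h.1 h'.1) (R'.right_unique h.2 h'.2)
  left_unique h h' := Prod.ext (R.left_unique h.1 h'.1) (R'.left_unique h.2 h'.2)
  rel_one := by simp [R.rel_one, R'.rel_one, Prod.ext_iff]
  rel_mul := by
    intro a b x z
    rw [R.rel_mul, R'.rel_mul]
    exact ⟨fun ⟨⟨y, h₁, h₂⟩, ⟨y', h₁', h₂'⟩⟩ => ⟨(y, y'), ⟨h₁, h₁'⟩, h₂, h₂'⟩,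
      fun ⟨y, h, h'⟩ => ⟨⟨y.1, h.1, h'.1⟩, ⟨y.2, h.2, h'.2⟩⟩⟩
  rel_smul g h := ⟨R.rel_smul g.1 h.1, R'.rel_smul g.2 h.2⟩

/-- The product of two equivariant functions. -/
noncomputable def tensorFunctions :
    equivariantFunctions X σ ⊗[𝕜] equivariantFunctions X' σ' →ₗ[𝕜]
      equivariantFunctions (X × X') (extTensor σ σ') :=
  TensorProduct.lift (LinearMap.mk₂ 𝕜
    (fun f f' => ⟨fun x => f.1 x.1 ⊗ₜ f'.1 x.2, fun g x => by
      change f.1 (g.1 • x.1) ⊗ₜ f'.1 (g.2 • x.2) = _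
      rw [f.2, f'.2]
      rfl⟩)
    (fun _ _ _ => by ext x; exact TensorProduct.add_tmul _ _ _)
    (fun _ _ _ => by ext x; exact TensorProduct.smul_tmul' _ _ _)
    (fun _ _ _ => by ext x; exact TensorProduct.tmul_add _ _ _)
    (fun _ _ _ => by ext x; exact TensorProduct.tmul_smul _ _ _))

theorem tensorFunctions_tmul (f : equivariantFunctions X σ) (f' : equivariantFunctions X' σ')
    (x : X × X') : (tensorFunctions σ σ' (f ⊗ₜ f')).1 x = f.1 x.1 ⊗ₜ f'.1 x.2 := rfl

/-- On pure tensors the sum over `G × G'` factors. This reduces the inverse of `tensorFunctions` to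
`sum_delta` for the product group. -/
theorem tensorFunctions_delta [Fintype G] [Fintype G'] (x : X × X') (w : U ⊗[𝕜] U') :
    tensorFunctions σ σ' (TensorProduct.map (delta σ x.1) (delta σ' x.2) w) =
      delta (extTensor σ σ') x w := by
  classical
  induction w with
  | zero => simp
  | add w w' h h' => rw [map_add, map_add, map_add, h, h']
  | tmul u u' =>
    ext y
    rw [TensorProduct.map_tmul, tensorFunctions_tmul, delta_apply, delta_apply, delta_apply,
      Fintype.sum_prod_type, TensorProduct.sum_tmul]
    refine Finset.sum_congr rfl fun g _ => ?_
    rw [TensorProduct.tmul_sum]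
    refine Finset.sum_congr rfl fun g' _ => ?_
    have : (g, g') • x = y ↔ g • x.1 = y.1 ∧ g' • x.2 = y.2 := Prod.ext_iff
    by_cases h : g • x.1 = y.1
    · by_cases h' : g' • x.2 = y.2
      · rw [if_pos h, if_pos h', if_pos (this.2 ⟨h, h'⟩)]
        rfl
      · rw [if_neg h', if_neg fun h => h' (this.1 h).2, TensorProduct.tmul_zero]
    · rw [if_neg h, if_neg fun h' => h (this.1 h').1, TensorProduct.zero_tmul]

/-- The tensor product of spaces of equivariant functions is the space of equivariant functions
on the product. -/
noncomputable def tensorEquiv [Fintype G] [Fintype G'] [Fintype X] [Fintype X'] [CharZero 𝕜] :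
    ((R.rep σ).tprod (R'.rep σ')).Equiv ((R.prod R').rep (extTensor σ σ')) :=
  have hG : (Fintype.card G : 𝕜) * Fintype.card G' ≠ 0 := by simp
  .mk
    (LinearEquiv.ofLinearMap (tensorFunctions σ σ')
      (((Fintype.card G : 𝕜) * Fintype.card G')⁻¹ • ∑ x : X × X',
        TensorProduct.map (delta σ x.1) (delta σ' x.2) ∘ₗ LinearMap.proj x ∘ₗ
          Submodule.subtype _)
      (by
        ext1 f
        simp only [LinearMap.comp_apply, LinearMap.smul_apply, map_smul, LinearMap.sum_apply,
          map_sum, LinearMap.proj_apply, Submodule.subtype_apply, tensorFunctions_delta,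
          sum_delta, LinearMap.id_apply, Fintype.card_prod, Nat.cast_mul]
        rw [inv_smul_smul₀ hG])
      (by
        ext1
        ext1 f
        ext1 f'
        simp only [LinearMap.comp_apply, LinearMap.smul_apply, LinearMap.sum_apply,
          LinearMap.proj_apply, Submodule.subtype_apply, LinearMap.id_apply,
          TensorProduct.AlgebraTensorModule.curry_apply, TensorProduct.curry_apply,
          LinearMap.coe_restrictScalars, tensorFunctions_tmul, TensorProduct.map_tmul]
        rw [Fintype.sum_prod_type]
        simp only [← TensorProduct.tmul_sum, ← TensorProduct.sum_tmul, sum_delta]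
        rw [TensorProduct.smul_tmul_smul, inv_smul_smul₀ hG]))
    fun a => by
      ext f f' y
      change (R.act a f.1 y.1) ⊗ₜ (R'.act a f'.1 y.2) = (R.prod R').act a _ y
      rcases R.act_cases (U := U) a y.1 with ⟨x, hx, h⟩ | ⟨hx, h⟩
      · rcases R'.act_cases (U := U') a y.2 with ⟨x', hx', h'⟩ | ⟨hx', h'⟩
        · rw [h, h', (R.prod R').act_of_rel (x := (x, x')) ⟨hx, hx'⟩]
          rfl
        · rw [h', TensorProduct.tmul_zero, (R.prod R').act_of_forall_not]
          exact fun z hz => hx' _ hz.2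
      · rw [h, TensorProduct.zero_tmul, (R.prod R').act_of_forall_not]
        exact fun z hz => hx _ hz.1

end Tensor

/-! ### Irreducibility and isomorphisms -/

section Irreducible

variable {𝕜 M G X U W : Type*} [Field 𝕜] [Monoid M] [Group G] [MulAction G X]
  [AddCommGroup U] [Module 𝕜 U] [AddCommGroup W] [Module 𝕜 W]
  (R : PartialAction M G X)

/-- Any orbit of `G` can be mapped to any other by an element of `M` that is undefined on all
remaining points. -/
def Transporting : Prop :=
  ∀ x y, ∃ a, R.Rel a x y ∧ ∀ z w, R.Rel a z w → ∃ g : G, z = g • x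

variable {R} [Fintype G] {σ : Representation 𝕜 G U} {τ : Representation 𝕜 G W}

/-- Such an `a` discards all of `f` except its restriction to the orbit of `x`, which is determined
by `f x`, and moves it to the orbit of `y`. Because the action is free, `delta σ y` has no
stabilizer factor. -/
theorem rep_eq_delta (hX : ∀ (g : G) (x : X), g • x = x → g = 1) {a : M} {x y : X}
    (hxy : R.Rel a x y) (ha : ∀ z w, R.Rel a z w → ∃ g : G, z = g • x)
    (f : equivariantFunctions X σ) : R.rep σ a f = delta σ y (f.1 x) := by
  ext w
  rw [rep_apply]
  rcases R.act_cases (U := U) a w with ⟨z, hz, h⟩ | ⟨hw, h⟩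
  · obtain ⟨g, rfl⟩ := ha z w hz
    obtain rfl := R.right_unique (R.rel_smul g hxy) hz
    rw [h, f.2, delta_apply_smul_of_free σ hX]
  · rw [h, delta_apply_of_forall_ne]
    rintro g rfl
    exact hw _ (R.rel_smul g hxy)

theorem nontrivial_equivariantFunctions [Nonempty X] [Nontrivial U]
    (hX : ∀ (g : G) (x : X), g • x = x → g = 1) (σ : Representation 𝕜 G U) :
    Nontrivial (equivariantFunctions X σ) := by
  obtain ⟨u, hu⟩ := exists_ne (0 : U)
  obtain ⟨x⟩ := ‹Nonempty X›
  refine ⟨delta σ x u, 0, fun h => hu ?_⟩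
  rw [← delta_apply_self_of_free σ hX x u, h]
  rfl

/-- The equivariant functions with values in an irreducible representation form an irreducible
representation. -/
theorem Transporting.isIrreducible_rep [CharZero 𝕜] [Fintype X] [Nonempty X]
    (hR : R.Transporting) (hX : ∀ (g : G) (x : X), g • x = x → g = 1) (hσ : σ.IsIrreducible) :
    (R.rep σ).IsIrreducible := by
  have hG : (Fintype.card G : 𝕜) ≠ 0 := by simp
  have := hσ.nontrivial
  have := nontrivial_equivariantFunctions hX σ
  have hne : (⊥ : Subrepresentation (R.rep σ)) ≠ ⊤ := fun h => by
    obtain ⟨f, hf⟩ := exists_ne (0 : equivariantFunctions X σ)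
    have : f ∈ (⊥ : Subrepresentation (R.rep σ)) := by rw [h]; exact Submodule.mem_top
    exact hf ((Submodule.mem_bot 𝕜).1 this)
  have : Nontrivial (Subrepresentation (R.rep σ)) := ⟨⊥, ⊤, hne⟩
  refine ⟨fun N => or_iff_not_imp_left.2 fun hN => ?_⟩
  obtain ⟨f, hfN, hf⟩ : ∃ f ∈ N.toSubmodule, f ≠ 0 := by
    by_contra! h
    refine hN (Subrepresentation.toSubmodule_injective ?_)
    exact (Submodule.eq_bot_iff _).2 h
  obtain ⟨x, hx⟩ : ∃ x, f.1 x ≠ 0 := by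
    by_contra! h
    exact hf (Subtype.ext (funext h))
  have hmem : ∀ f ∈ N.toSubmodule, ∀ x y, delta σ y (f.1 x) ∈ N.toSubmodule := fun f hf x y => by
    obtain ⟨a, hxy, ha⟩ := hR x y
    rw [← rep_eq_delta hX hxy ha]
    exact N.apply_mem_toSubmodule a hf
  -- The vectors `u` whose function `delta σ x u` lies in `N`. They are stable under `G` because `σ
  -- g u` is the value of that function at `g • x`, and `hmem` moves this value back to `x`.
  let N' : Subrepresentation σ :=
    { toSubmodule := N.toSubmodule.comap (delta σ x)
      apply_mem_toSubmodule := fun g u hu => by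
        have h := hmem _ hu (g • x) x
        rwa [delta_apply_smul_of_free σ hX] at h }
  have hN' : N' = ⊤ := by
    refine (hσ.eq_bot_or_eq_top N').resolve_left fun h => hx ?_
    have : f.1 x ∈ N' := hmem f hfN x x
    rw [h] at this
    exact (Submodule.mem_bot 𝕜).1 this
  have hall : ∀ u y, delta σ y u ∈ N.toSubmodule := fun u y => by
    have h : u ∈ N' := by rw [hN']; exact Submodule.mem_top
    have h' := hmem _ h x y
    rwa [delta_apply_self_of_free σ hX] at h'
  refine Subrepresentation.toSubmodule_injective ((Submodule.eq_top_iff').2 fun f => ?_)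
  rw [← inv_smul_smul₀ hG f, ← sum_delta σ f]
  exact Submodule.smul_mem _ _ (Submodule.sum_mem _ fun y _ => hall _ y)

/-- Cutting out the value at `x` and placing it at `y` is the action of an element of `M`, so it
commutes with `e`. -/
theorem Transporting.equiv_delta (hR : R.Transporting)
    (hX : ∀ (g : G) (x : X), g • x = x → g = 1) (e : (R.rep σ).Equiv (R.rep τ)) (x y : X)
    (f : equivariantFunctions X σ) : e (delta σ y (f.1 x)) = delta τ y ((e f).1 x) := by
  obtain ⟨a, hxy, ha⟩ := hR x y
  rw [← rep_eq_delta hX hxy ha, ← rep_eq_delta hX hxy ha]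
  exact Representation.IntertwiningMap.isIntertwining _ _ e.toIntertwiningMap a f

/-- The coefficients can be recovered from the representation on equivariant functions. -/
theorem Transporting.nonempty_equiv_iff [Nonempty X]
    (hR : R.Transporting) (hX : ∀ (g : G) (x : X), g • x = x → g = 1) :
    Nonempty ((R.rep σ).Equiv (R.rep τ)) ↔ Nonempty (σ.Equiv τ) := by
  refine ⟨fun ⟨e⟩ => ?_, fun ⟨e⟩ => ⟨R.repCongr e⟩⟩
  obtain ⟨x⟩ := ‹Nonempty X›
  -- The isomorphism sends `u` to the value at `x` of the image of `delta σ x u`; `equiv_delta`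
  -- shows that this value determines the image.
  refine ⟨.mk
    { toFun := fun u => (e (delta σ x u)).1 x
      map_add' := fun u v => by
        rw [map_add]
        exact congrFun (congrArg Subtype.val (map_add e.toLinearEquiv _ _)) x
      map_smul' := fun c u => by
        rw [map_smul]
        exact congrFun (congrArg Subtype.val (map_smul e.toLinearEquiv _ _)) x
      invFun := fun w => (e.symm (delta τ x w)).1 x
      left_inv := fun u => ?_
      right_inv := fun w => ?_ } fun g => ?_⟩
  · have h := hR.equiv_delta hX e x x (delta σ x u)
    rw [delta_apply_self_of_free σ hX] at h
    beta_reduce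
    rw [← h, e.symm_apply_apply, delta_apply_self_of_free σ hX]
  · have h := hR.equiv_delta hX e.symm x x (delta τ x w)
    rw [delta_apply_self_of_free τ hX] at h
    beta_reduce
    rw [← h, e.apply_symm_apply, delta_apply_self_of_free τ hX]
  · ext u
    -- By `delta_smul`, placing `σ g u` at `x` is the same as placing `u` at `g⁻¹ • x`. On the other
    -- side, evaluation at `x = g • g⁻¹ • x` then produces `τ g`.
    have h := hR.equiv_delta hX e x (g⁻¹ • x) (delta σ x u)
    rw [delta_apply_self_of_free σ hX] at h
    change (e (delta σ x (σ g u))).1 x = τ g ((e (delta σ x u)).1 x)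
    rw [← delta_smul σ g⁻¹ x, ← Module.End.mul_apply, ← map_mul, inv_mul_cancel, map_one,
      Module.End.one_apply, h]
    simpa using delta_apply_smul_of_free τ hX (g⁻¹ • x) g ((e (delta σ x u)).1 x)

/-- Partial actions that are defined on different elements of `M` give nonisomorphic
representations. -/
theorem not_nonempty_equiv_of_rel {G' X' : Type*} [Group G'] [MulAction G' X']
    {R' : PartialAction M G' X'} {τ : Representation 𝕜 G' W} [Nontrivial U]
    (hX : ∀ (g : G) (x : X), g • x = x → g = 1) {a : M} {x y : X} (h : R.Rel a x y)
    (h' : ∀ z w, ¬ R'.Rel a z w) : ¬ Nonempty ((R.rep σ).Equiv (R'.rep τ)) := by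
  rintro ⟨e⟩
  obtain ⟨u, hu⟩ := exists_ne (0 : U)
  have h0 : R'.rep τ a (e (delta σ x u)) = 0 := by
    ext w
    rw [rep_apply, R'.act_of_forall_not fun z => h' z w]
    rfl
  have h1 : e (R.rep σ a (delta σ x u)) = R'.rep τ a (e (delta σ x u)) :=
    Representation.IntertwiningMap.isIntertwining _ _ e.toIntertwiningMap _ _
  rw [h0, R.rep_delta_of_rel σ h] at h1
  have h2 : delta σ y u = 0 := e.toLinearEquiv.map_eq_zero_iff.1 h1
  refine hu ?_
  rw [← delta_apply_self_of_free σ hX y u, h2]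
  rfl

end Irreducible

end PartialAction

/-! ### Induced representations as equivariant functions -/

/-- The group `K` as a left `H`-set by means of a homomorphism `φ : H → K`. -/
def TranslationSet {H K : Type*} [Group H] [Group K] (_ : H →* K) : Type _ := K

namespace TranslationSet

variable {H K : Type*} [Group H] [Group K] (φ : H →* K)

instance : Group (TranslationSet φ) := inferInstanceAs (Group K)

instance [Fintype K] : Fintype (TranslationSet φ) := inferInstanceAs (Fintype K)

/-- The identity map. -/
def of : K ≃* TranslationSet φ := MulEquiv.refl K

instance : MulAction H (TranslationSet φ) :=
  MulAction.compHom _ ((of φ).toMonoidHom.comp φ)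

theorem smul_def (h : H) (x : TranslationSet φ) : h • x = of φ (φ h) * x := rfl

/-- The action of `K` on itself by right translations `x ↦ x k⁻¹`. -/
def rightTranslation : PartialAction K H (TranslationSet φ) where
  Rel k x y := y * of φ k = x
  right_unique h h' := mul_right_cancel (h.trans h'.symm)
  left_unique h h' := h.symm.trans h'
  rel_one := by
    intro x y
    rw [map_one, mul_one, eq_comm]
  rel_mul := by
    intro a b x z
    constructor
    · rintro rfl
      exact ⟨z * of φ a, by rw [map_mul, mul_assoc], rfl⟩
    · rintro ⟨y, rfl, rfl⟩
      rw [map_mul, mul_assoc]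
  rel_smul := by
    rintro k x y h rfl
    rw [smul_def, smul_def, mul_assoc]

/-- For finite groups in characteristic zero, the induced representation consists of the
equivariant functions on the group. -/
noncomputable def indEquiv {𝕜 U : Type*} [Field 𝕜] [CharZero 𝕜] [AddCommGroup U] [Module 𝕜 U]
    [Fintype H] [Fintype K] (ρ : Representation 𝕜 H U) :
    (Representation.ind φ ρ).Equiv ((rightTranslation φ).rep ρ) :=
  have hb : ∀ x, (MonoidAlgebra.basis K 𝕜).reindex (of φ).toEquiv x =
      MonoidAlgebra.single ((of φ).symm x) 1 := fun x => by
    rw [Module.Basis.reindex_apply, MonoidAlgebra.basis_apply]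
    rfl
  -- The induced representation is a space of coinvariants of `𝕜[K] ⊗ U` in which `a` translates the
  -- basis `K` from the right by `a⁻¹`, so `coinvariantsEquiv` applies.
  have hT : ∀ (a : K) (x : TranslationSet φ) (u : U), Representation.ind φ ρ a
      (Representation.Coinvariants.mk _
        ((MonoidAlgebra.basis K 𝕜).reindex (of φ).toEquiv x ⊗ₜ u)) =
      Representation.Coinvariants.mk _
        ((MonoidAlgebra.basis K 𝕜).reindex (of φ).toEquiv (x * of φ a⁻¹) ⊗ₜ u) := fun a x u => by
    rw [hb, hb]
    exact Representation.ind_mk φ ρ a _ u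
  (rightTranslation φ).coinvariantsEquiv ρ ((MonoidAlgebra.basis K 𝕜).reindex (of φ).toEquiv)
    (fun g x => by
      rw [hb, hb]
      simp [smul_def])
    _
    (fun a x y u h => by
      obtain rfl := h
      rw [hT, mul_assoc, ← map_mul, mul_inv_cancel, map_one, mul_one])
    (fun a x u h => absurd (show (x * of φ a⁻¹) * of φ a = x by
      rw [mul_assoc, ← map_mul, inv_mul_cancel, map_one, mul_one]) (h _))

end TranslationSet

/-! ### Decomposition of equivariant functions along stabilizers -/

namespace PartialAction

open TranslationSet (of rightTranslation)

variable {𝕜 M G Z U I : Type*} [Field 𝕜] [Monoid M] [Group G] [MulAction G Z]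
  [AddCommGroup U] [Module 𝕜 U] {X K : I → Type*} [∀ i, Group (K i)] [∀ i, MulAction (K i) (X i)]

/-- The equivariant functions on a `G`-set which is composed, up to the action of `G`, of sets
`X i` on which the stabilizers `H i` act through homomorphisms `φ i : H i → K i`. -/
theorem nonempty_equiv_piRep (R : PartialAction M G Z) (σ : Representation 𝕜 G U)
    (R' : ∀ i, PartialAction M (K i) (X i)) (H : I → Subgroup G) (φ : ∀ i, H i →* K i)
    (ι : ∀ i, X i → Z) (hι : ∀ i, Function.Injective (ι i))
    (hφ : ∀ i (h : H i) c, ι i (φ i h • c) = h.1 • ι i c)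
    (hindex : ∀ i j c c' (g : G), g • ι i c = ι j c' → i = j)
    (hstab : ∀ i c c' (g : G), g • ι i c = ι i c' → g ∈ H i)
    (hcover : ∀ z, ∃ i c, ∃ g : G, g • ι i c = z)
    (hrel : ∀ i a c c', R.Rel a (ι i c) (ι i c') ↔ (R' i).Rel a c c')
    (hrange : ∀ i a z c, R.Rel a z (ι i c) → ∃ c', ι i c' = z) :
    Nonempty ((R.rep σ).Equiv (Representation.piRep
      (T := fun i => equivariantFunctions (X i)
        ((rightTranslation (φ i)).rep (σ.comp (H i).subtype)))
      fun i => (R' i).rep ((rightTranslation (φ i)).rep (σ.comp (H i).subtype)))) := by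
  -- The component of `f` at `i` is `c ↦ (k ↦ f (ι i (k • c)))`. It is `H i`-equivariant in `k`
  -- because `f` is equivariant, and `K i`-equivariant in `c` because moving `c` translates `k`.
  let F : equivariantFunctions Z σ →ₗ[𝕜] ∀ i, equivariantFunctions (X i)
      ((rightTranslation (φ i)).rep (σ.comp (H i).subtype)) :=
    { toFun := fun f i => ⟨fun c => ⟨fun k => f.1 (ι i ((of (φ i)).symm k • c)), fun h k => by
          beta_reduce
          rw [TranslationSet.smul_def, map_mul, MulEquiv.symm_apply_apply, mul_smul, hφ, f.2]
          rfl⟩, fun k c => by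
        ext k'
        rw [rep_apply, act_of_rel (x := k' * of (φ i) k) _ rfl]
        change f.1 (ι i ((of (φ i)).symm k' • k • c)) =
          f.1 (ι i ((of (φ i)).symm (k' * of (φ i) k) • c))
        rw [map_mul, mul_smul, MulEquiv.symm_apply_apply]⟩
      map_add' := fun _ _ => rfl
      map_smul' := fun _ _ => rfl }
  have hF : ∀ f i c k, ((F f i).1 c).1 k = f.1 (ι i ((of (φ i)).symm k • c)) :=
    fun _ _ _ _ => rfl
  have hF1 : ∀ f i c, ((F f i).1 c).1 1 = f.1 (ι i c) := fun f i c => by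
    rw [hF, map_one, one_smul]
  -- By equivariance in `c`, all values are determined by those at `k = 1`; what remains is a
  -- function of `c` that is equivariant under `H i` only.
  have heval : ∀ i (f : equivariantFunctions (X i)
      ((rightTranslation (φ i)).rep (σ.comp (H i).subtype))) c k,
      (f.1 c).1 k = (f.1 ((of (φ i)).symm k • c)).1 1 := fun i f c k => by
    rw [f.2, rep_apply, act_of_rel (x := k)]
    change 1 * of (φ i) ((of (φ i)).symm k) = k
    simp
  have hinj : Function.Injective F := by
    intro f f' h
    ext z
    obtain ⟨i, c, g, rfl⟩ := hcover z
    rw [f.2, f'.2, ← hF1, ← hF1, h]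
  have hsurj : Function.Surjective F := by
    intro f'
    choose i c g hz using hcover
    -- The values prescribed on the pieces are consistent: if `g` links two points of pieces, they
    -- lie in the same piece, `g` lies in its `H i`, and `c' = φ i g • c`, so `H i`-equivariance
    -- relates the values.
    have hwd : ∀ i c j c' (g : G), g • ι i c = ι j c' →
        ((f' j).1 c').1 1 = σ g (((f' i).1 c).1 1) := by
      intro i c j c' g h
      obtain rfl := hindex _ _ _ _ _ h
      have hg := hstab _ _ _ _ h
      obtain rfl : φ i ⟨g, hg⟩ • c = c' := hι i ((hφ i ⟨g, hg⟩ c).trans h)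
      have h1 := heval i (f' i) c (of (φ i) (φ i ⟨g, hg⟩))
      rw [MulEquiv.symm_apply_apply] at h1
      rw [← h1]
      have h2 := ((f' i).1 c).2 ⟨g, hg⟩ 1
      rwa [TranslationSet.smul_def, mul_one] at h2
    refine ⟨⟨fun z => σ (g z) (((f' (i z)).1 (c z)).1 1), fun h z => ?_⟩, ?_⟩
    · have := hwd (i z) (c z) (i (h • z)) (c (h • z)) ((g (h • z))⁻¹ * h * g z) (by
        rw [mul_smul, mul_smul, hz, inv_smul_eq_iff, hz])
      beta_reduce
      rw [this, ← Module.End.mul_apply, ← Module.End.mul_apply, ← map_mul, ← map_mul]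
      congr 2
      group
    · ext j c' k
      rw [hF, heval j (f' j)]
      exact (hwd _ _ _ _ _ (hz _)).symm
  refine ⟨.mk (LinearEquiv.ofBijective F ⟨hinj, hsurj⟩) fun a => ?_⟩
  ext f i c k
  change ((F (R.rep σ a f) i).1 c).1 k = (((R' i).act a (F f i).1) c).1 k
  rw [hF, rep_apply]
  by_cases hc : ∃ c', (R' i).Rel a c' c
  · obtain ⟨c', hc⟩ := hc
    rw [(R' i).act_of_rel hc, hF, R.act_of_rel]
    exact (hrel _ _ _ _).2 ((R' i).rel_smul _ hc)
  · push Not at hc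
    rw [(R' i).act_of_forall_not hc, R.act_of_forall_not]
    · rfl
    · intro z hz
      obtain ⟨c', rfl⟩ := hrange _ _ _ _ hz
      rw [hrel] at hz
      refine hc (((of (φ i)).symm k)⁻¹ • c') (((R' i).rel_smul_iff ((of (φ i)).symm k)).1 ?_)
      rwa [smul_inv_smul]

end PartialAction

namespace PIStar

variable {n : ℕ} {I J : Type*}

/-! ### Colorings -/

/-- `a` sends the color classes of `c` to the color classes of `d`; uncolored points are marked
`none`. -/
def Maps (a : PIStar n) (c d : Fin n → Option I) : Prop :=
  (∀ x y, a.rel x y → c x = d y) ∧ (∀ x, c x ≠ none → a.InDom x) ∧ ∀ y, d y ≠ none → a.InCod y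

theorem Maps.right_unique {a : PIStar n} {c d d' : Fin n → Option I} (h : a.Maps c d)
    (h' : a.Maps c d') : d = d' := by
  funext y
  by_cases hy : a.InCod y
  · obtain ⟨x, hx⟩ := hy
    rw [← h.1 x y hx, h'.1 x y hx]
  · rw [not_imp_comm.1 (h.2.2 y) hy, not_imp_comm.1 (h'.2.2 y) hy]

theorem Maps.left_unique {a : PIStar n} {c c' d : Fin n → Option I} (h : a.Maps c d)
    (h' : a.Maps c' d) : c = c' := by
  funext x
  by_cases hx : a.InDom x
  · obtain ⟨y, hy⟩ := hx
    rw [h.1 x y hy, h'.1 x y hy]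
  · rw [not_imp_comm.1 (h.2.1 x) hx, not_imp_comm.1 (h'.2.1 x) hx]

theorem maps_one {c d : Fin n → Option I} : (1 : PIStar n).Maps c d ↔ c = d := by
  constructor
  · intro h
    funext x
    exact h.1 x x rfl
  · rintro rfl
    exact ⟨fun x y h => congrArg c h, fun x _ => ⟨x, rfl⟩, fun x _ => ⟨x, rfl⟩⟩

theorem rel_mul_of_alive {a b : PIStar n} {x u z : Fin n} (hx : b.rel x u) (hu : Alive a b u)
    (hz : a.rel u z) : (a * b).rel x z :=
  ⟨u, u, hx, .refl u, hu, hz⟩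

/-- The color of a middle point agrees with that of any point related to it by `b` or `a`, so it
cannot change along a connection. -/
theorem Maps.conn {a b : PIStar n} {c d e : Fin n → Option I} (hb : b.Maps c d)
    (ha : a.Maps d e) {u v : Fin n} (h : Conn a b u v) : d u = d v := by
  induction h with
  | rel u v h =>
    rcases h with ⟨x, hu, hv⟩ | ⟨z, hu, hv⟩
    · rw [← hb.1 x u hu, hb.1 x v hv]
    · rw [ha.1 u z hu, ha.1 v z hv]
  | refl => rfl
  | symm _ _ _ ih => exact ih.symm
  | trans _ _ _ _ _ ih₁ ih₂ => exact ih₁.trans ih₂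

theorem Maps.alive {a b : PIStar n} {c d e : Fin n → Option I} (hb : b.Maps c d)
    (ha : a.Maps d e) {u : Fin n} (h : d u ≠ none) : Alive a b u := fun v huv => by
  rw [hb.conn ha huv] at h
  exact ⟨hb.2.2 v h, ha.2.1 v h⟩

theorem Maps.mul {a b : PIStar n} {c d e : Fin n → Option I} (hb : b.Maps c d)
    (ha : a.Maps d e) : (a * b).Maps c e := by
  refine ⟨?_, fun x hx => ?_, fun z hz => ?_⟩
  · rintro x z ⟨u, v, hxu, huv, -, hvz⟩
    rw [hb.1 x u hxu, hb.conn ha huv, ha.1 v z hvz]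
  · obtain ⟨u, hu⟩ := hb.2.1 x hx
    rw [hb.1 x u hu] at hx
    obtain ⟨z, hz⟩ := ha.2.1 u hx
    exact ⟨z, rel_mul_of_alive hu (hb.alive ha hx) hz⟩
  · obtain ⟨u, hu⟩ := ha.2.2 z hz
    rw [← ha.1 u z hu] at hz
    obtain ⟨x, hx⟩ := hb.2.2 u hz
    exact ⟨x, rel_mul_of_alive hx (hb.alive ha hz) hu⟩

/-- The middle coloring is forced: `u` receives the color of any `x` with `b.rel x u`, and no color
outside the codomain of `b`. It is well defined because the component of a colored point survives in
the composite, where `e` determines the color. -/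
theorem Maps.exists_of_mul {a b : PIStar n} {c e : Fin n → Option I} (h : (a * b).Maps c e) :
    ∃ d, b.Maps c d ∧ a.Maps d e := by
  classical
  -- the points connected to a colored point are alive
  have alive : ∀ x u, b.rel x u → c x ≠ none → Alive a b u := fun x u hxu hx => by
    obtain ⟨z, u', v, hxu', -, hu', -⟩ := h.2.1 x hx
    exact hu'.conn (.rel _ _ (Or.inl ⟨x, hxu', hxu⟩))
  have alive' : ∀ u z, a.rel u z → e z ≠ none → Alive a b u := fun u z huz hz => by
    obtain ⟨x, u', v, -, hu'v, hu', hvz⟩ := h.2.2 z hz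
    exact (hu'.conn hu'v).conn (.rel _ _ (Or.inr ⟨z, hvz, huz⟩))
  -- If either end is colored, then `u` is alive and `x` and `z` are related by the product;
  -- otherwise both colors are `none`.
  have color : ∀ x u z, b.rel x u → a.rel u z → c x = e z := fun x u z hxu huz => by
    by_cases hx : c x = none
    · by_cases hz : e z = none
      · rw [hx, hz]
      · exact h.1 _ _ (rel_mul_of_alive hxu (alive' u z huz hz) huz)
    · exact h.1 _ _ (rel_mul_of_alive hxu (alive x u hxu hx) huz)
  have same : ∀ x x' u, b.rel x u → b.rel x' u → c x ≠ none → c x = c x' :=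
    fun x x' u hx hx' h => by
      obtain ⟨-, z, hz⟩ := alive x u hx h u (.refl u)
      rw [color x u z hx hz, color x' u z hx' hz]
  have same' : ∀ x x' u, b.rel x u → b.rel x' u → c x = c x' := fun x x' u hx hx' => by
    by_cases h : c x = none
    · by_cases h' : c x' = none
      · rw [h, h']
      · exact (same x' x u hx' hx h').symm
    · exact same x x' u hx hx' h
  let d : Fin n → Option I := fun u => if hu : b.InCod u then c hu.choose else none
  have hd : ∀ x u, b.rel x u → c x = d u := fun x u hxu => by
    have hu : b.InCod u := ⟨x, hxu⟩
    change c x = if hu : b.InCod u then c hu.choose else none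
    rw [dif_pos hu]
    exact same' _ _ _ hxu hu.choose_spec
  have hd' : ∀ u, d u ≠ none → b.InCod u := fun u hu => by
    by_contra h
    exact hu (dif_neg h)
  refine ⟨d, ⟨hd, fun x hx => ?_, hd'⟩, fun u z huz => ?_, fun u hu => ?_, fun z hz => ?_⟩
  · obtain ⟨z, u, -, hu, -⟩ := h.2.1 x hx
    exact ⟨u, hu⟩
  · by_cases hu : b.InCod u
    · obtain ⟨x, hx⟩ := hu
      rw [← hd x u hx, color x u z hx huz]
    -- Here `u` is uncolored. A colored `z` would make `u` alive and put it in the codomain of `b`.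
    · rw [not_imp_comm.1 (hd' u) hu]
      by_contra hz
      exact hu (alive' u z huz (Ne.symm hz) u (.refl u)).1
  · obtain ⟨x, hx⟩ := hd' u hu
    rw [← hd x u hx] at hu
    exact (alive x u hx hu u (.refl u)).2
  · obtain ⟨x, u, v, -, -, -, hv⟩ := h.2.2 z hz
    exact ⟨v, hv⟩

theorem Maps.comp {a : PIStar n} {c d : Fin n → Option I} (h : a.Maps c d)
    (f : Option I → Option J) (hf : f none = none) : a.Maps (f ∘ c) (f ∘ d) :=
  ⟨fun x y hxy => congrArg f (h.1 x y hxy), fun x hx => h.2.1 x fun h' => hx (by simp [h', hf]),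
    fun x hx => h.2.2 x fun h' => hx (by simp [h', hf])⟩

/-- The element that sends the `i`-th color class of `c` to the `i`-th color class of `d`. -/
def arrow (c d : Fin n → Option I) : PIStar n where
  rel x y := ∃ i, c x = some i ∧ d y = some i
  difunctional := by
    rintro x y x' y' ⟨i, hx, hy⟩ ⟨j, hx', hy'⟩ ⟨j', hx'', hy''⟩
    refine ⟨i, hx, ?_⟩
    rw [hy''.trans (hx''.symm.trans hx'), ← hy', hy]

end PIStar

/-! ### The module of equivariant functions on colorings -/

/-- The colorings of subsets of `Fin n` with all of `k` colors, that is, the set partitions of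
subsets of `Fin n` into `k` labeled parts. -/
abbrev Coloring (n k : ℕ) : Type := {c : Fin n → Option (Fin k) // ∀ i, ∃ x, c x = some i}

namespace Coloring

variable {n k m : ℕ}

open PIStar (arrow Maps)

noncomputable instance : Fintype (Coloring n k) := Fintype.ofFinite _

instance : MulAction (Equiv.Perm (Fin k)) (Coloring n k) where
  smul g c := ⟨fun x => (c.1 x).map g, fun i => by
    obtain ⟨x, hx⟩ := c.2 (g⁻¹ i)
    exact ⟨x, by simp [hx]⟩⟩
  one_smul c := by
    apply Subtype.ext
    funext x
    exact congrFun Option.map_id _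
  mul_smul g h c := by
    apply Subtype.ext
    funext x
    change (c.1 x).map (g * h) = ((c.1 x).map h).map g
    rw [Option.map_map]
    rfl

theorem smul_apply (g : Equiv.Perm (Fin k)) (c : Coloring n k) (x : Fin n) :
    (g • c).1 x = (c.1 x).map g := rfl

theorem eq_one_of_smul_eq (g : Equiv.Perm (Fin k)) (c : Coloring n k) (h : g • c = c) : g = 1 := by
  ext i : 1
  obtain ⟨x, hx⟩ := c.2 i
  have := smul_apply g c x
  rw [h, hx] at this
  exact (Option.some_injective _ this).symm

instance nonempty_fin (m : Fin (n + 1)) : Nonempty (Coloring n m) :=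
  ⟨⟨fun x => if h : x.1 < m then some ⟨x, h⟩ else none, fun i =>
    ⟨⟨i, i.2.trans_le (Nat.lt_succ_iff.1 m.2)⟩, by simp⟩⟩⟩

theorem le (c : Coloring n k) : k ≤ n := by
  choose f hf using c.2
  simpa using Fintype.card_le_of_injective f fun i j h =>
    Option.some_injective _ (by rw [← hf i, ← hf j, h])

variable (n k) in
/-- The partial action of `PI_n^*` on colorings. -/
def partialAction : PartialAction (PIStar n) (Equiv.Perm (Fin k)) (Coloring n k) where
  Rel a c d := a.Maps c.1 d.1
  right_unique h h' := Subtype.ext (h.right_unique h')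
  left_unique h h' := Subtype.ext (h.left_unique h')
  rel_one := PIStar.maps_one.trans Subtype.ext_iff.symm
  rel_mul := by
    intro a b c e
    refine ⟨fun h => ?_, fun ⟨d, hb, ha⟩ => hb.mul ha⟩
    obtain ⟨d, hb, ha⟩ := h.exists_of_mul
    refine ⟨⟨d, fun i => ?_⟩, hb, ha⟩
    obtain ⟨x, hx⟩ := c.2 i
    obtain ⟨u, hu⟩ := hb.2.1 x (by simp [hx])
    exact ⟨u, by rw [← hb.1 x u hu, hx]⟩
  rel_smul g h := h.comp (Option.map g) rfl

theorem maps_arrow (c d : Coloring n k) : (arrow c.1 d.1).Maps c.1 d.1 := by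
  refine ⟨fun x y ⟨i, hx, hy⟩ => hx.trans hy.symm, fun x hx => ?_, fun y hy => ?_⟩
  · obtain ⟨i, hi⟩ := Option.ne_none_iff_exists'.1 hx
    obtain ⟨y, hy⟩ := d.2 i
    exact ⟨y, i, hi, hy⟩
  · obtain ⟨i, hi⟩ := Option.ne_none_iff_exists'.1 hy
    obtain ⟨x, hx⟩ := c.2 i
    exact ⟨x, i, hx, hi⟩

theorem arrow_injective (p : Coloring n k) {c d : Coloring n k}
    (h : arrow p.1 c.1 = arrow p.1 d.1) : c = d :=
  Subtype.ext ((maps_arrow p c).right_unique (h ▸ maps_arrow p d))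

/-- If `a` sends `d` to `d'`, then composition with `a` sends `p → d` to `p → d'`. -/
theorem mul_arrow_of_maps {a : PIStar n} (p : Coloring n k) {d d' : Coloring n k}
    (h : a.Maps d.1 d'.1) : a * arrow p.1 d.1 = arrow p.1 d'.1 := by
  have hm := (maps_arrow p d).mul h
  ext x z
  constructor
  · intro hxz
    obtain ⟨u, v, ⟨i, hi, -⟩, -⟩ := id hxz
    exact ⟨i, hi, by rw [← hm.1 x z hxz, hi]⟩
  · rintro ⟨i, hx, hz⟩
    obtain ⟨x', hx'⟩ := hm.2.2 z (by simp [hz])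
    have hx'i : p.1 x' = some i := (hm.1 _ _ hx').trans hz
    obtain ⟨u, v, ⟨j, hj, hu⟩, h'⟩ := hx'
    exact ⟨u, v, ⟨j, by rw [hx, ← hj, hx'i], hu⟩, h'⟩

/-- An arrow relates all points of color `i` to one common point `y`, whose color under `e'` is the
color of each of them under `e`. -/
theorem eq_of_maps_arrow {c d : Coloring n k} {e e' : Fin n → Option (Fin m)}
    (h : (arrow c.1 d.1).Maps e e') {x x' : Fin n} {i : Fin k} (hx : c.1 x = some i)
    (hx' : c.1 x' = some i) : e x = e x' := by
  obtain ⟨y, hy⟩ := d.2 i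
  rw [h.1 x y ⟨i, hx, hy⟩, h.1 x' y ⟨i, hx', hy⟩]

/-- An arrow between colorings is defined on coarser colorings only. -/
theorem exists_injective_of_maps_arrow {c d : Coloring n k} {e e' : Coloring n m}
    (h : (arrow c.1 d.1).Maps e.1 e'.1) : ∃ f : Fin m → Fin k, Function.Injective f ∧
      ∀ j, ∃ x, e.1 x = some j ∧ c.1 x = some (f j) := by
  choose p hp using e.2
  have hne : ∀ j, ∃ i, c.1 (p j) = some i := fun j => by
    obtain ⟨y, i, hi, -⟩ := h.2.1 (p j) (by simp [hp])
    exact ⟨i, hi⟩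
  choose f hf using hne
  refine ⟨f, fun j j' hjj => ?_, fun j => ⟨p j, hp j, hf j⟩⟩
  have := eq_of_maps_arrow h (hf j) (by rw [hf j', hjj])
  rwa [hp, hp, Option.some_inj] at this

/-- Such arrows annihilate the module for `m` colors but not the one for `k` colors, which keeps the
two apart. -/
theorem not_maps_arrow_of_lt (hkm : k < m) (c d : Coloring n k) (e e' : Coloring n m) :
    ¬ (arrow c.1 d.1).Maps e.1 e'.1 := fun h => by
  obtain ⟨f, hf, -⟩ := exists_injective_of_maps_arrow h
  exact absurd (Fintype.card_le_of_injective f hf) (by simpa using hkm)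

/-- With equally many colors, the injection of `exists_injective_of_maps_arrow` is a bijection, so a
coloring on which the arrow from `c` is defined can only be a recoloring of `c`. -/
theorem transporting : (partialAction n k).Transporting := by
  refine fun c d => ⟨arrow c.1 d.1, maps_arrow c d, fun e e' h => ?_⟩
  obtain ⟨f, hf, hfe⟩ := exists_injective_of_maps_arrow h
  let g : Equiv.Perm (Fin k) := Equiv.ofBijective f (Finite.injective_iff_bijective.1 hf)
  refine ⟨g⁻¹, Subtype.ext (funext fun x => ?_)⟩
  rw [smul_apply]
  cases hx : c.1 x with
  | none =>
    rw [Option.map_none]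
    by_contra hne
    obtain ⟨y, i, hi, -⟩ := h.2.1 x hne
    rw [hx] at hi
    cases hi
  | some i =>
    obtain ⟨j, rfl⟩ := g.surjective i
    obtain ⟨x', hx', hj⟩ := hfe j
    rw [eq_of_maps_arrow h hx hj, hx']
    simp

/-! ### The left cells -/

/-- If `a * b` fixes the identity arrow at `p` from the left, then `b` must carry `p` to some
coloring `d`, and the product of `b` with this arrow is `p → d`. Conversely, `p → d` and `d → p`
generate each other's left ideals in the required way. -/
theorem greenL_iff (p : Coloring n k) (ξ : PIStar n) :
    GreenL ξ (arrow p.1 p.1) ↔ ∃ d : Coloring n k, ξ = arrow p.1 d.1 := by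
  constructor
  · rintro ⟨⟨a, ha⟩, b, rfl⟩
    have hab : (a * (b * arrow p.1 p.1)).Maps p.1 p.1 := by
      rw [ha]
      exact maps_arrow p p
    obtain ⟨d, hd, -⟩ := hab.exists_of_mul
    obtain ⟨e, he, hb⟩ := hd.exists_of_mul
    obtain rfl := he.right_unique (maps_arrow p p)
    -- The second factorization shows that the middle coloring uses all `k` colors.
    obtain ⟨d', hd', -⟩ := ((partialAction n k).rel_mul (x := p) (z := p)).1 hab
    obtain rfl := hd.right_unique hd'
    exact ⟨d', mul_arrow_of_maps p hb⟩
  · rintro ⟨d, rfl⟩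
    exact ⟨⟨arrow d.1 p.1, mul_arrow_of_maps p (maps_arrow d p)⟩, arrow p.1 d.1,
      mul_arrow_of_maps p (maps_arrow p d)⟩

/-- The converse of `mul_arrow_of_maps`: the coloring between the two factors can only be `d`. Hence
a product leaves the left cell exactly when `a` is undefined on `d`. -/
theorem maps_of_mul_arrow {a : PIStar n} {p d d' : Coloring n k}
    (h : a * arrow p.1 d.1 = arrow p.1 d'.1) : a.Maps d.1 d'.1 := by
  have hm : (a * arrow p.1 d.1).Maps p.1 d'.1 := h ▸ maps_arrow p d'
  obtain ⟨e, he, ha⟩ := hm.exists_of_mul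
  rwa [(maps_arrow p d).right_unique he]

end Coloring

/-! ### Cell modules in terms of colorings -/

namespace OrderedPartition

variable {n k : ℕ} (P : OrderedPartition n k)

open PIStar (arrow)

open Classical in
/-- The coloring by the parts of an ordered partition. -/
noncomputable def coloring : Coloring n k :=
  have h : ∀ x i, x ∈ P.part i →
      (if h : ∃ i, x ∈ P.part i then some h.choose else none) = some i := fun x i hi => by
    have hx : ∃ i, x ∈ P.part i := ⟨i, hi⟩
    rw [dif_pos hx, P.eq_of_mem hx.choose_spec hi]
  ⟨fun x => if h : ∃ i, x ∈ P.part i then some h.choose else none, fun i =>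
    ⟨(P.nonempty i).choose, h _ i (P.nonempty i).choose_spec⟩⟩

theorem coloring_eq_some_iff {x : Fin n} {i : Fin k} :
    P.coloring.1 x = some i ↔ x ∈ P.part i := by
  classical
  change (if h : ∃ i, x ∈ P.part i then some h.choose else none) = some i ↔ _
  split_ifs with h
  · rw [Option.some_inj]
    exact ⟨fun h' => h' ▸ h.choose_spec, P.eq_of_mem h.choose_spec⟩
  · exact ⟨fun h' => h'.elim, fun h' => (h ⟨i, h'⟩).elim⟩

/-- The inverse appears because a point of part `s i` has to receive the color `i`. -/
theorem toMaxSubgroup_apply (s : Equiv.Perm (Fin k)) :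
    P.toMaxSubgroup s = arrow P.coloring.1 (s⁻¹ • P.coloring).1 := by
  ext x y
  refine exists_congr fun i => ?_
  rw [coloring_eq_some_iff, Coloring.smul_apply, Option.map_eq_some_iff]
  refine and_congr_right fun _ => ⟨fun h => ⟨s i, P.coloring_eq_some_iff.2 h, by simp⟩, ?_⟩
  rintro ⟨j, hj, rfl⟩
  simpa using P.coloring_eq_some_iff.1 hj

theorem toMaxSubgroup_one : P.toMaxSubgroup 1 = arrow P.coloring.1 P.coloring.1 := by
  rw [toMaxSubgroup_apply, inv_one, one_smul]

theorem greenL_toMaxSubgroup_one_iff (ξ : PIStar n) :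
    GreenL ξ (P.toMaxSubgroup 1) ↔ ∃ d : Coloring n k, ξ = arrow P.coloring.1 d.1 := by
  rw [toMaxSubgroup_one, Coloring.greenL_iff]

/-- The elements of the left cell are the colorings. -/
noncomputable def coloringEquivLeftCell : Coloring n k ≃ LeftCell (P.toMaxSubgroup 1) :=
  Equiv.ofBijective
    (fun c => ⟨arrow P.coloring.1 c.1, (P.greenL_toMaxSubgroup_one_iff _).2 ⟨c, rfl⟩⟩)
    ⟨fun c d h => Coloring.arrow_injective P.coloring (congrArg Subtype.val h), fun ξ => by
      obtain ⟨d, hd⟩ := (P.greenL_toMaxSubgroup_one_iff _).1 ξ.2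
      exact ⟨d, Subtype.ext hd.symm⟩⟩

theorem coloringEquivLeftCell_apply (c : Coloring n k) :
    (P.coloringEquivLeftCell c).1 = arrow P.coloring.1 c.1 := rfl

/-- The module `N^lam` as a space of equivariant functions on colorings. -/
noncomputable def simpleNEquiv (𝕜 : Type*) [Field 𝕜] [CharZero 𝕜] (lam : YoungDiagram) :
    (simpleN 𝕜 P lam).Equiv ((Coloring.partialAction n k).rep (specht 𝕜 lam k)) :=
  have hb : ∀ c, (Finsupp.basisSingleOne (R := 𝕜)).reindex P.coloringEquivLeftCell.symm c =
      Finsupp.single (P.coloringEquivLeftCell c) 1 := fun c => by simp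
  (Coloring.partialAction n k).coinvariantsEquiv (specht 𝕜 lam k)
    ((Finsupp.basisSingleOne (R := 𝕜)).reindex P.coloringEquivLeftCell.symm)
    (fun g c => by
      rw [hb, hb]
      refine (Finsupp.mapDomain_single).trans ?_
      congr 1
      apply Subtype.ext
      change (P.coloringEquivLeftCell c).1 * P.toMaxSubgroup g⁻¹ = _
      rw [coloringEquivLeftCell_apply, coloringEquivLeftCell_apply, toMaxSubgroup_apply, inv_inv]
      -- The arrow from the coloring of `P` to `c` also carries the recoloring by `g` of the former
      -- to that of `c`.
      exact Coloring.mul_arrow_of_maps _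
        ((Coloring.partialAction n k).rel_smul g (Coloring.maps_arrow _ c)))
    _
    (fun a c d u h => by
      rw [hb, hb]
      change Representation.Coinvariants.mk _ (cellRep 𝕜 (P.toMaxSubgroup 1) a _ ⊗ₜ u) = _
      have h' := Coloring.mul_arrow_of_maps P.coloring h
      have hL : GreenL (a * (P.coloringEquivLeftCell c).1) (P.toMaxSubgroup 1) := by
        rw [coloringEquivLeftCell_apply, h']
        exact (P.coloringEquivLeftCell d).2
      congr 2
      refine (Finsupp.linearCombination_single _ _ _).trans ?_
      rw [one_smul, dif_pos hL]
      congr 1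
      exact Subtype.ext h')
    (fun a c u h => by
      rw [hb]
      change Representation.Coinvariants.mk _ (cellRep 𝕜 (P.toMaxSubgroup 1) a _ ⊗ₜ u) = _
      have h0 : cellRep 𝕜 (P.toMaxSubgroup 1) a (Finsupp.single (P.coloringEquivLeftCell c) 1) =
          0 := by
        refine (Finsupp.linearCombination_single _ _ _).trans ?_
        rw [one_smul, dif_neg]
        intro hL
        obtain ⟨d, hd⟩ := (P.greenL_toMaxSubgroup_one_iff _).1 hL
        exact h d (Coloring.maps_of_mul_arrow hd)
      rw [h0, TensorProduct.zero_tmul, map_zero])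

end OrderedPartition

/-! ### Pairs of colorings and their patterns -/

namespace QTilde

variable {n k l m m' : ℕ}

instance : Finite (QTilde k l m) := Finite.of_injective _ mat_injective

theorem nonempty_equiv_ones (M : QTilde k l m) : Nonempty (Fin m ≃ M.Ones) :=
  ⟨(Finite.equivFinOfCardEq M.card_ones).symm⟩

theorem posPerm_none (g : Equiv.Perm (Fin k) × Equiv.Perm (Fin l)) :
    posPerm g (none, none) = (none, none) := rfl

/-- The position of the entry with a given label, where the label `none` stands for the position
`(0, 0)`. -/
def pos (M : QTilde k l m) (ψ : Fin m ≃ M.Ones) (j : Option (Fin m)) :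
    Option (Fin k) × Option (Fin l) :=
  j.elim (none, none) fun j => (ψ j).1

theorem ne_none_of_mat {M : QTilde k l m} {p : Option (Fin k) × Option (Fin l)}
    (hp : M.mat p.1 p.2 = true) : p ≠ (none, none) := by
  rintro rfl
  rw [M.zero_zero] at hp
  cases hp

theorem pos_some_ne (M : QTilde k l m) (ψ : Fin m ≃ M.Ones) (j : Fin m) :
    M.pos ψ (some j) ≠ (none, none) := ne_none_of_mat (ψ j).2

theorem pos_injective (M : QTilde k l m) (ψ : Fin m ≃ M.Ones) :
    Function.Injective (M.pos ψ) := by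
  intro i j h
  cases i with
  | none =>
    cases j with
    | none => rfl
    | some j => exact absurd h.symm (M.pos_some_ne ψ j)
  | some i =>
    cases j with
    | none => exact absurd h (M.pos_some_ne ψ i)
    | some j => rw [ψ.injective (Subtype.ext h)]

theorem pos_stabToPerm (M : QTilde k l m) (ψ : Fin m ≃ M.Ones) (h : M.stab) (j : Option (Fin m)) :
    M.pos ψ (j.map (M.stabToPerm ψ h)) = posPerm h.1 (M.pos ψ j) := by
  cases j with
  | none => rfl
  | some j =>
    change (ψ (ψ.symm (M.stabToOnes h (ψ j)))).1 = _
    rw [Equiv.apply_symm_apply]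
    rfl

/-- The pair of colors of a point. -/
def pairAt (z : Coloring n k × Coloring n l) (x : Fin n) : Option (Fin k) × Option (Fin l) :=
  (z.1.1 x, z.2.1 x)

theorem pairAt_injective :
    Function.Injective (pairAt : Coloring n k × Coloring n l → Fin n → _) := fun _ _ h =>
  Prod.ext (Subtype.ext (funext fun x => congrArg Prod.fst (congrFun h x)))
    (Subtype.ext (funext fun x => congrArg Prod.snd (congrFun h x)))

theorem pairAt_smul (g : Equiv.Perm (Fin k) × Equiv.Perm (Fin l))
    (z : Coloring n k × Coloring n l) (x : Fin n) : pairAt (g • z) x = posPerm g (pairAt z x) :=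
  rfl

/-- The pair of colorings given by a matrix `M` and a coloring by the entries `1` of `M`: they
color a point by the row and by the column of the entry. -/
def toPair (M : QTilde k l m) (ψ : Fin m ≃ M.Ones) (c : Coloring n m) :
    Coloring n k × Coloring n l :=
  (⟨fun x => (M.pos ψ (c.1 x)).1, fun i => by
    obtain ⟨j, hj⟩ := M.row_ne_zero i
    obtain ⟨x, hx⟩ := c.2 (ψ.symm ⟨(some i, j), hj⟩)
    exact ⟨x, by simp [hx, pos]⟩⟩,
  ⟨fun x => (M.pos ψ (c.1 x)).2, fun j => by
    obtain ⟨i, hi⟩ := M.col_ne_zero j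
    obtain ⟨x, hx⟩ := c.2 (ψ.symm ⟨(i, some j), hi⟩)
    exact ⟨x, by simp [hx, pos]⟩⟩)

theorem pairAt_toPair (M : QTilde k l m) (ψ : Fin m ≃ M.Ones) (c : Coloring n m) (x : Fin n) :
    pairAt (M.toPair ψ c) x = M.pos ψ (c.1 x) := rfl

theorem toPair_injective (M : QTilde k l m) (ψ : Fin m ≃ M.Ones) :
    Function.Injective (M.toPair ψ : Coloring n m → _) := fun _ _ h =>
  Subtype.ext (funext fun x => M.pos_injective ψ (congrFun (congrArg pairAt h) x))

theorem toPair_smul (M : QTilde k l m) (ψ : Fin m ≃ M.Ones) (h : M.stab) (c : Coloring n m) :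
    M.toPair ψ (M.stabToPerm ψ h • c) = h.1 • M.toPair ψ c :=
  pairAt_injective (funext fun _ => M.pos_stabToPerm ψ h _)

/-- The entries `1` of `M` are the pairs of colors that occur in `z`. -/
def IsPattern (M : QTilde k l m) (z : Coloring n k × Coloring n l) : Prop :=
  ∀ p, M.mat p.1 p.2 = true ↔ p ≠ (none, none) ∧ ∃ x, pairAt z x = p

theorem isPattern_toPair (M : QTilde k l m) (ψ : Fin m ≃ M.Ones) (c : Coloring n m) :
    M.IsPattern (M.toPair ψ c) := by
  intro p
  constructor
  · intro hp
    obtain ⟨x, hx⟩ := c.2 (ψ.symm ⟨p, hp⟩)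
    exact ⟨ne_none_of_mat hp, x, by simp [pairAt_toPair, hx, pos]⟩
  · rintro ⟨hp, x, rfl⟩
    rw [pairAt_toPair] at hp ⊢
    cases h : c.1 x with
    | none =>
      rw [h] at hp
      exact absurd rfl hp
    | some j => exact (ψ j).2

/-- Each point is labeled by the entry of `M` at its pair of colors. With `toPair_injective`, this
identifies the pairs with pattern `M` with the colorings by `m` colors. -/
theorem IsPattern.exists_toPair {M : QTilde k l m} {z : Coloring n k × Coloring n l}
    (h : M.IsPattern z) (ψ : Fin m ≃ M.Ones) : ∃ c, M.toPair ψ c = z := by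
  classical
  have hex : ∀ x, ∃ j, M.pos ψ j = pairAt z x := fun x => by
    by_cases hx : pairAt z x = (none, none)
    · exact ⟨none, hx.symm⟩
    · exact ⟨some (ψ.symm ⟨_, (h _).2 ⟨hx, x, rfl⟩⟩), by simp [pos]⟩
  choose c hc using hex
  refine ⟨⟨c, fun j => ?_⟩, pairAt_injective (funext fun x => hc x)⟩
  obtain ⟨-, x, hx⟩ := (h _).1 (ψ j).2
  exact ⟨x, M.pos_injective ψ ((hc x).trans hx)⟩

theorem IsPattern.smul {M : QTilde k l m} {z : Coloring n k × Coloring n l}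
    (h : M.IsPattern z) (g : Equiv.Perm (Fin k) × Equiv.Perm (Fin l)) :
    (g • M).IsPattern (g • z) := by
  intro p
  obtain ⟨p, rfl⟩ := (posPerm g).surjective p
  rw [smul_mat, h p, ← (posPerm g).injective.ne_iff, posPerm_none]
  refine and_congr_right fun _ => exists_congr fun x => ?_
  rw [pairAt_smul, (posPerm g).injective.eq_iff]

theorem IsPattern.eq {M M' : QTilde k l m} {z : Coloring n k × Coloring n l}
    (h : M.IsPattern z) (h' : M'.IsPattern z) : M = M' := by
  apply mat_injective
  ext i j
  rw [Bool.eq_iff_iff, h (i, j), h' (i, j)]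

theorem IsPattern.card_eq {M : QTilde k l m} {M' : QTilde k l m'}
    {z : Coloring n k × Coloring n l} (h : M.IsPattern z) (h' : M'.IsPattern z) : m = m' := by
  rw [← M.card_ones, ← M'.card_ones]
  exact Nat.card_congr (Equiv.subtypeEquivRight fun p => (h p).trans (h' p).symm)

theorem exists_isPattern (z : Coloring n k × Coloring n l) :
    ∃ (m : ℕ) (M : QTilde k l m), M.IsPattern z := by
  classical
  refine ⟨_, ⟨fun i j => decide ((i, j) ≠ (none, none) ∧ ∃ x, pairAt z x = (i, j)), by simp, rfl,
    fun i => ?_, fun j => ?_⟩, fun p => by simp⟩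
  · obtain ⟨x, hx⟩ := z.1.2 i
    exact ⟨z.2.1 x, by simpa using ⟨x, by rw [pairAt, hx]⟩⟩
  · obtain ⟨x, hx⟩ := z.2.2 j
    exact ⟨z.1.1 x, by simpa using ⟨x, by rw [pairAt, hx]⟩⟩

/-- A label and its position determine each other, and a position of a `1`-entry has a positive row
or column index. Thus `a` respects the labels iff it respects both coordinates, also as regards the
uncolored points. -/
theorem rel_toPair_iff (M : QTilde k l m) (ψ : Fin m ≃ M.Ones) (a : PIStar n)
    (c c' : Coloring n m) :
    ((Coloring.partialAction n k).prod (Coloring.partialAction n l)).Rel a (M.toPair ψ c)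
      (M.toPair ψ c') ↔ (Coloring.partialAction n m).Rel a c c' := by
  have hne : ∀ j : Fin m, (M.pos ψ (some j)).1 ≠ none ∨ (M.pos ψ (some j)).2 ≠ none := fun j => by
    have := M.pos_some_ne ψ j
    rw [Ne, Prod.ext_iff] at this
    exact not_and_or.1 this
  constructor
  · rintro ⟨h, h'⟩
    refine ⟨fun x y hxy => M.pos_injective ψ (Prod.ext (h.1 x y hxy) (h'.1 x y hxy)),
      fun x hx => ?_, fun x hx => ?_⟩
    · obtain ⟨j, hj⟩ := Option.ne_none_iff_exists'.1 hx
      rcases hne j with hj' | hj' <;> rw [← hj] at hj'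
      exacts [h.2.1 x hj', h'.2.1 x hj']
    · obtain ⟨j, hj⟩ := Option.ne_none_iff_exists'.1 hx
      rcases hne j with hj' | hj' <;> rw [← hj] at hj'
      exacts [h.2.2 x hj', h'.2.2 x hj']
  · intro h
    exact ⟨h.comp (fun j => (M.pos ψ j).1) rfl, h.comp (fun j => (M.pos ψ j).2) rfl⟩

/-- Every point with a pair other than `(none, none)`, on either side, is related by `a` to a point
with the same pair. So the pairs with pattern `M` are closed under taking preimages. -/
theorem IsPattern.of_rel {M : QTilde k l m} {a : PIStar n} {z z' : Coloring n k × Coloring n l}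
    (hz : M.IsPattern z')
    (h : ((Coloring.partialAction n k).prod (Coloring.partialAction n l)).Rel a z z') :
    M.IsPattern z := by
  have heq : ∀ x y, a.rel x y → pairAt z x = pairAt z' y := fun x y hxy =>
    Prod.ext (h.1.1 x y hxy) (h.2.1 x y hxy)
  intro p
  rw [hz p]
  refine and_congr_right fun hp => ⟨?_, ?_⟩
  · rintro ⟨y, rfl⟩
    rw [Ne, Prod.ext_iff, not_and_or] at hp
    obtain ⟨x, hx⟩ : a.InCod y := hp.elim (h.1.2.2 y) (h.2.2.2 y)
    exact ⟨x, heq x y hx⟩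
  · rintro ⟨x, rfl⟩
    rw [Ne, Prod.ext_iff, not_and_or] at hp
    obtain ⟨y, hy⟩ : a.InDom x := hp.elim (h.1.2.1 x) (h.2.2.1 x)
    exact ⟨y, (heq x y hy).symm⟩

end QTilde

/-! ### Decomposition of the tensor product by patterns -/

theorem exists_isCrossSection (G X : Type*) [Group G] [MulAction G X] [Finite X] :
    ∃ C : Finset X, IsCrossSection G C := by
  classical
  let q : X → Quotient (MulAction.orbitRel G X) := Quotient.mk _
  refine ⟨(Set.toFinite (Set.range fun c : Quotient (MulAction.orbitRel G X) => c.out)).toFinset,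
    fun x => ⟨(q x).out, ⟨by simp, ?_⟩, ?_⟩⟩
  · exact (MulAction.orbitRel_apply (G := G)).1 (Quotient.mk_out x)
  · rintro y ⟨hy, hyx⟩
    simp only [Set.Finite.mem_toFinset, Set.mem_range] at hy
    obtain ⟨c, rfl⟩ := hy
    have : c = q x := by
      rw [← Quotient.out_eq c]
      exact Quotient.sound ((MulAction.orbitRel_apply (G := G)).2 hyx)
    rw [this]

open TranslationSet (rightTranslation)

/-- The tensor product of the modules of equivariant functions on colorings decomposes according
to the patterns of pairs of colorings. -/
theorem QTilde.nonempty_equiv_piRep {𝕜 U : Type*} [Field 𝕜] [AddCommGroup U] [Module 𝕜 U]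
    {n k l : ℕ} (σ : Representation 𝕜 (Equiv.Perm (Fin k) × Equiv.Perm (Fin l)) U)
    (C : ∀ m, Finset (QTilde k l m))
    (hC : ∀ m, IsCrossSection (Equiv.Perm (Fin k) × Equiv.Perm (Fin l)) (C m))
    (ψ : ∀ m (M : QTilde k l m), Fin m ≃ M.Ones) :
    Nonempty ((((Coloring.partialAction n k).prod (Coloring.partialAction n l)).rep σ).Equiv
      (Representation.piRep
        (T := fun i : Σ m : Fin (n + 1), C m => ↥(equivariantFunctions (Coloring n i.1)
          ((rightTranslation (i.2.1.stabToPerm (ψ i.1 i.2.1))).rep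
            (σ.comp i.2.1.stab.subtype))))
        fun i => (Coloring.partialAction n i.1).rep
          ((rightTranslation (i.2.1.stabToPerm (ψ i.1 i.2.1))).rep
            (σ.comp i.2.1.stab.subtype)))) := by
  refine PartialAction.nonempty_equiv_piRep (I := Σ m : Fin (n + 1), C m)
    (X := fun i => Coloring n i.1) (K := fun i => Equiv.Perm (Fin i.1)) _ σ
    (fun i => Coloring.partialAction n i.1) (fun i => i.2.1.stab)
    (fun i => i.2.1.stabToPerm (ψ i.1 i.2.1)) (fun i => i.2.1.toPair (ψ i.1 i.2.1))
    (fun i => i.2.1.toPair_injective _) (fun i => i.2.1.toPair_smul _) ?_ ?_ ?_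
    (fun i => i.2.1.rel_toPair_iff _) (fun i a z c h => ?_)
  · rintro ⟨m, M⟩ ⟨m', M'⟩ c c' g h
    have h₁ := (M.1.isPattern_toPair (ψ m M.1) c).smul g
    have h₂ := M'.1.isPattern_toPair (ψ m' M'.1) c'
    dsimp only at h
    rw [h] at h₁
    obtain rfl : m = m' := Fin.ext (h₁.card_eq h₂)
    have hM : g • M.1 = M'.1 := h₁.eq h₂
    congr 1
    exact Subtype.ext ((hC m M.1).unique ⟨M.2, MulAction.mem_orbit_self _⟩ ⟨M'.2, g, hM⟩)
  · rintro ⟨m, M⟩ c c' g h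
    have h₁ := (M.1.isPattern_toPair (ψ m M.1) c).smul g
    dsimp only at h
    rw [h] at h₁
    exact h₁.eq (M.1.isPattern_toPair (ψ m M.1) c')
  · intro z
    obtain ⟨m, M, hM⟩ := QTilde.exists_isPattern z
    -- This coloring serves to bound `m` by `n`; the representing coloring `c'` belongs to the
    -- translate of `M` in the cross-section.
    obtain ⟨c, -⟩ := hM.exists_toPair (ψ m M)
    obtain ⟨_, hM', g, rfl⟩ := (hC m M).exists
    obtain ⟨c', hc'⟩ := (hM.smul g).exists_toPair (ψ m (g • M))
    refine ⟨⟨⟨m, Nat.lt_succ_of_le c.le⟩, ⟨g • M, hM'⟩⟩, c', g⁻¹, ?_⟩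
    rw [inv_smul_eq_iff]
    exact hc'
  · exact ((i.2.1.isPattern_toPair _ c).of_rel h).exists_toPair _

/-- Modules of equivariant functions on colorings with different numbers of colors are not
isomorphic. -/
theorem Coloring.not_nonempty_equiv {𝕜 U W : Type*} [Field 𝕜] [AddCommGroup U] [Module 𝕜 U]
    [AddCommGroup W] [Module 𝕜 W] {n k m : ℕ} (h : k ≠ m) [Nonempty (Coloring n k)]
    [Nonempty (Coloring n m)] [Nontrivial U] (σ : Representation 𝕜 (Equiv.Perm (Fin k)) U)
    (τ : Representation 𝕜 (Equiv.Perm (Fin m)) W) :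
    ¬ Nonempty (((partialAction n k).rep σ).Equiv ((partialAction n m).rep τ)) := by
  rcases h.lt_or_gt with h | h
  · obtain ⟨c⟩ := ‹Nonempty (Coloring n k)›
    exact PartialAction.not_nonempty_equiv_of_rel eq_one_of_smul_eq (maps_arrow c c)
      (not_maps_arrow_of_lt h c c)
  · rintro ⟨e⟩
    -- The argument with the roles exchanged needs a nonzero coefficient in `W`. If there is none,
    -- one function space vanishes and the other does not.
    rcases subsingleton_or_nontrivial W with hW | hW
    · have := PartialAction.nontrivial_equivariantFunctions (X := Coloring n k)
        eq_one_of_smul_eq σ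
      exact not_subsingleton _ e.toLinearEquiv.toEquiv.subsingleton
    · obtain ⟨c⟩ := ‹Nonempty (Coloring n m)›
      exact PartialAction.not_nonempty_equiv_of_rel eq_one_of_smul_eq (maps_arrow c c)
        (not_maps_arrow_of_lt h c c) ⟨e.symm⟩

/-! ### Counting irreducible summands -/

instance (𝕜 : Type*) [Field 𝕜] (lam : YoungDiagram) (k : ℕ) :
    FiniteDimensional 𝕜 (SpechtModule 𝕜 lam k) := by
  have : Finite (Tableau lam k) := Equiv.finite_right
  exact FiniteDimensional.span_of_finite 𝕜 (Set.finite_range _)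

theorem Nat.card_sigma_subtype {ι : Type*} {κ : ι → Type*} [Fintype ι] [∀ i, Finite (κ i)]
    (p : (Σ i, κ i) → Prop) : Nat.card {x // p x} = ∑ i, Nat.card {j // p ⟨i, j⟩} := by
  classical
  have : ∀ i, Fintype (κ i) := fun i => Fintype.ofFinite _
  simp only [Nat.card_eq_fintype_card, Fintype.card_subtype, Finset.card_filter,
    Fintype.sum_sigma]

/-- Decompositions of the coefficients induce decompositions of the modules of equivariant
functions. -/
noncomputable def PartialAction.repSigma {𝕜 M I : Type*} [Field 𝕜] [Monoid M] {X K T : I → Type*}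
    [∀ i, Group (K i)] [∀ i, MulAction (K i) (X i)] [∀ i, AddCommGroup (T i)]
    [∀ i, Module 𝕜 (T i)] {τ : ∀ i, Representation 𝕜 (K i) (T i)} {κ : I → Type*}
    {S : ∀ i, κ i → Type*} [∀ i j, AddCommGroup (S i j)] [∀ i j, Module 𝕜 (S i j)]
    (σ : ∀ i j, Representation 𝕜 (K i) (S i j)) (R : ∀ i, PartialAction M (K i) (X i))
    (e : ∀ i, (τ i).Equiv (Representation.piRep (σ i))) :
    (Representation.piRep (T := fun i => ↥(equivariantFunctions (X i) (τ i)))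
      fun i => (R i).rep (τ i)).Equiv
    (Representation.piRep
      (T := fun x : Σ i, κ i => ↥(equivariantFunctions (X x.1) (σ x.1 x.2)))
      fun x => (R x.1).rep (σ x.1 x.2)) :=
  .trans (τ := Representation.piRep
      (T := fun x : Σ i, κ i => ↥(equivariantFunctions (X x.1) (σ x.1 x.2)))
      fun x => (R x.1).rep (σ x.1 x.2))
    (Representation.piRepCongr (T := fun i => ↥(equivariantFunctions (X i) (τ i)))
      (T' := fun i => ∀ j, ↥(equivariantFunctions (X i) (σ i j)))
      (τ' := fun i => Representation.piRep fun j => (R i).rep (σ i j))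
      fun i => ((R i).repCongr (e i)).trans ((R i).repPi (σ i)))
    (Representation.piRepSigma (T := fun i j => ↥(equivariantFunctions (X i) (σ i j)))
      fun i j => (R i).rep (σ i j))

/-- Multiplicities in products of modules of equivariant functions on colorings. -/
theorem Coloring.repMultiplicity_eq_sum {𝕜 V U : Type*} [Field 𝕜] [CharZero 𝕜] [AddCommGroup V]
    [Module 𝕜 V] [AddCommGroup U] [Module 𝕜 U] {n : ℕ} {J : Fin (n + 1) → Type*}
    [∀ m, Fintype (J m)] {T : (Σ m, J m) → Type*} [∀ i, AddCommGroup (T i)]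
    [∀ i, Module 𝕜 (T i)] [∀ i, FiniteDimensional 𝕜 (T i)]
    (τ : ∀ i : Σ m, J m, Representation 𝕜 (Equiv.Perm (Fin i.1)) (T i))
    {ρ : Representation 𝕜 (PIStar n) V}
    (e : ρ.Equiv (Representation.piRep
      (T := fun i => ↥(equivariantFunctions (Coloring n i.1) (τ i)))
      fun i => (partialAction n i.1).rep (τ i))) (m : Fin (n + 1))
    (σ : Representation 𝕜 (Equiv.Perm (Fin m)) U) :
    repMultiplicity ρ ((partialAction n m).rep σ) =
      ∑ j : J m, repMultiplicity (τ ⟨m, j⟩) σ := by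
  choose r S hS f using fun i => (τ i).exists_equiv_piRep
  let e' := e.trans (PartialAction.repSigma (fun i j => (S i j).toRepresentation)
    (fun i => partialAction n i.1) fun i => (f i).some)
  rw [Representation.repMultiplicity_of_pi (fun x : Σ i, Fin (r i) =>
    transporting.isIrreducible_rep eq_one_of_smul_eq (hS x.1 x.2)) e',
    Nat.card_sigma_subtype, Fintype.sum_sigma, Finset.sum_eq_single m]
  · refine Finset.sum_congr rfl fun j _ => ?_
    rw [Representation.repMultiplicity_of_pi (hS _) (f _).some]
    exact Nat.card_congr (Equiv.subtypeEquivRight fun _ =>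
      transporting.nonempty_equiv_iff eq_one_of_smul_eq)
  -- Summands with a different number of colors contribute nothing.
  · intro m' _ hne
    refine Finset.sum_eq_zero fun j _ => ?_
    rw [Nat.card_eq_zero]
    refine Or.inl ⟨fun ⟨i, hi⟩ => ?_⟩
    have := (hS ⟨m', j⟩ i).nontrivial
    exact not_nonempty_equiv (fun h => hne (Fin.ext h)) _ _ hi
  · simp

theorem mainTheorem11 {𝕜 : Type*} [Field 𝕜] [IsAlgClosed 𝕜] [CharZero 𝕜]
    (n k l m : ℕ) (lam mu nu : YoungDiagram)
    (hlam : lam.card = k) (hmu : mu.card = l) (hnu : nu.card = m)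
    (P : OrderedPartition n k) (P' : OrderedPartition n l) (P'' : OrderedPartition n m)
    (C : Finset (QTilde k l m))
    (hC : IsCrossSection (Equiv.Perm (Fin k) × Equiv.Perm (Fin l)) C)
    (ψ : ∀ M : QTilde k l m, Fin m ≃ M.Ones) :
    repMultiplicity (Representation.tprod (simpleN 𝕜 P lam) (simpleN 𝕜 P' mu)) (simpleN 𝕜 P'' nu) =
      ∑ M ∈ C, M.indResMultiplicity 𝕜 (ψ M) lam mu nu := by
  classical
  -- The decomposition involves matrices with any number of ones, so the given cross-section and
  -- bijections are extended by arbitrary choices for the other numbers.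
  obtain ⟨C', hC', rfl⟩ : ∃ C' : ∀ m, Finset (QTilde k l m),
      (∀ m, IsCrossSection (Equiv.Perm (Fin k) × Equiv.Perm (Fin l)) (C' m)) ∧ C' m = C := by
    choose C₀ hC₀ using fun m => exists_isCrossSection (Equiv.Perm (Fin k) × Equiv.Perm (Fin l))
      (QTilde k l m)
    refine ⟨Function.update C₀ m C, fun m' => ?_, by simp⟩
    by_cases h : m' = m
    · subst h
      simpa using hC
    · rw [Function.update_of_ne h]
      exact hC₀ m'
  obtain ⟨ψ', rfl⟩ : ∃ ψ' : ∀ m (M : QTilde k l m), Fin m ≃ M.Ones, ψ' m = ψ :=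
    ⟨Function.update (fun _ M => Classical.choice M.nonempty_equiv_ones) m ψ, by simp⟩
  obtain ⟨e⟩ := QTilde.nonempty_equiv_piRep (n := n)
    (extTensor (specht 𝕜 lam k) (specht 𝕜 mu l)) C' hC' ψ'
  rw [Representation.repMultiplicity_congr_right _ (P''.simpleNEquiv 𝕜 nu)]
  have e' := ((Representation.tprodCongr (P.simpleNEquiv 𝕜 lam) (P'.simpleNEquiv 𝕜 mu)).trans
    (PartialAction.tensorEquiv _ _ _ _)).trans e
  -- The `m` disjoint nonempty parts of `P''` force `m ≤ n`, so `m` is among the indices of the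
  -- decomposition.
  have h := Coloring.repMultiplicity_eq_sum _ e' ⟨m, Nat.lt_succ_of_le P''.coloring.le⟩
    (specht 𝕜 nu m)
  rw [← Finset.sum_coe_sort]
  refine h.trans (Finset.sum_congr rfl fun M _ => Eq.symm ?_)
  exact Representation.repMultiplicity_congr_left (TranslationSet.indEquiv _ _) _
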